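/- Let $d\ge 1$. An axis-aligned rectangle in $\mathbb{R}^d$ is a set $R=\prod_{i=1}^d [a_i,b_i]$ with $a_i\le b_i$, where $a_i=-\infty$ and $b_i=\infty$ are allowed (the interval is then open at that end); it labels $x\in\mathbb{R}^d$ by $1$ if $x\in R$ and by $0$ otherwise. The odd-one-out oracle has on $x$ the only valid response $*$ if $x\in R$; otherwise its valid responses are the pairs $(i,1)$ with $x_i>b_i$ and the pairs $(i,0)$ with $x_i<a_i$. When $x$ is queried, an adversary selects one valid response, possibly depending (measurably) on the earlier queries. A streaming learner has a query tape, whose cells hold points of $\mathbb{R}^d$, a work tape of bits, a finite control, and two counters for the samples drawn and the queries made. At unit cost it can draw the next point of an unlabeled stream into a cell, remove a stored point or copy it to another cell, make an odd-one-out query on a stored point, read or write one bit, compare one coordinate of two stored points, or halt; the instruction executed depends on the control state and arbitrarily on the counters. Its memory is the number of cells plus the number of bits (we also add the number of control states). After halting it returns a classifier $A:\mathbb{R}^d\to\{0,1,\bot\}$ determined by the contents of its tapes. It is an RPU-learner with parameters $\varepsilon,\delta$ if for every rectangle $R$ and every adversary (1) (probably useful) for every probability distribution $D$ on $\mathbb{R}^d$,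 over an i.i.d. stream from $D$, $\Pr\big[\Pr_{x\sim D}[A(x)=\bot]>\varepsilon\big]<\delta$; (2) (reliable) for every stream and every $x$, if $A(x)\ne\bot$ then $A(x)$ is the label of $x$. There is an absolute constant $C>0$ such that for every $d\ge1$ there is an $M\le Cd$ such that for all $\varepsilon,\delta\in(0,1)$ there is an RPU-learner with parameters $\varepsilon,\delta$ for axis-aligned rectangles in $\mathbb{R}^d$ that uses memory at most $M$ (independent of $\varepsilon$ and $\delta$) and that, for every rectangle, every adversary and every stream, makes at most $$C\,d\log\frac{2}{\varepsilon\delta}$$ queries and halts after at most $$C\,\frac{d^2\log\big(\frac{2d}{\varepsilon\delta}\big)\log\big(\frac{2}{\varepsilon\delta}\big)}{\varepsilon}$$ steps. -/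

import Mathlib

/-- A nonempty axis-aligned rectangle in `ℝ^d`: a product of closed intervals `[a_i, b_i]`,
`a_i ≤ b_i`, where `a_i = -∞` and `b_i = ∞` are allowed (the interval is then open at that end). -/
structure Rectangle (d : ℕ) where
  lower : Fin d → EReal
  upper : Fin d → EReal
  lower_ne_top : ∀ i, lower i ≠ ⊤
  upper_ne_bot : ∀ i, upper i ≠ ⊥
  lower_le_upper : ∀ i, lower i ≤ upper i

namespace Rectangle

/-- The points of the rectangle. -/
def carrier {d : ℕ} (h : Rectangle d) : Set (Fin d → ℝ) :=
  {x | ∀ i, h.lower i ≤ (x i : EReal) ∧ (x i : EReal) ≤ h.upper i}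

open Classical in
/-- The binary classifier (indicator function) of the rectangle. -/
noncomputable def label {d : ℕ} (h : Rectangle d) (x : Fin d → ℝ) : Bool :=
  decide (x ∈ h.carrier)

end Rectangle

/-- Responses to an odd-one-out query: `none` is the response `*` (the point is positive),
`some (i, true)` says that coordinate `i` is too large and `some (i, false)` that it is too small. -/
abbrev OddResponse (d : ℕ) : Type := Option (Fin d × Bool)

/-- The odd-one-out oracle: the set of valid responses on the point `x` under the hypothesis `h`. -/
def oddOneOut {d : ℕ} (h : Rectangle d) (x : Fin d → ℝ) : Set (OddResponse d) :=
  {r | (h.label x = true ∧ r = none) ∨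
    (h.label x = false ∧ ∃ i, (r = some (i, true) ∧ h.upper i < (x i : EReal)) ∨
      (r = some (i, false) ∧ (x i : EReal) < h.lower i))}

/-- An adversary selecting responses adaptively: `adv n past x` is the response to the query `x` when
exactly `n` queries have been made before, on the points `past 0, …, past (n - 1)`
(the entries `past j` with `n ≤ j` carry no information, in a run they are `0`). -/
abbrev Adversary (d : ℕ) : Type := ℕ → (ℕ → Fin d → ℝ) → (Fin d → ℝ) → OddResponse d

namespace Adversary

/-- Every selected response is a valid odd-one-out response under the hypothesis `h`. -/
def IsValid {d : ℕ} (adv : Adversary d) (h : Rectangle d) : Prop :=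
  ∀ n past x, adv n past x ∈ oddOneOut h x

/-- The responses are jointly (Borel) measurable in the past queries and the current query. -/
def IsMeasurable {d : ℕ} (adv : Adversary d) : Prop :=
  ∀ n r, MeasurableSet {p : (ℕ → Fin d → ℝ) × (Fin d → ℝ) | adv n p.1 p.2 = r}

end Adversary

/-- The elementary instructions of a streaming learner whose query tape has `m` cells (each holding
one point or empty) and whose work tape has `w` bits; `Q` is the set of control states. Every
instruction takes one unit of time, and names the control state(s) in which the run continues.
The instructions `read` and `compare` are the only ways in which the content of the tapes can
influence the run. -/
inductive Instruction (d m w : ℕ) (Q : Type) : Type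
  /-- draw the next point of the stream and store it in cell `j` of the query tape -/
  | sample (j : Fin m) (next : Q)
  /-- remove the point in cell `j` of the query tape -/
  | erase (j : Fin m) (next : Q)
  /-- store the content of cell `j` of the query tape in cell `k` as well -/
  | copy (j k : Fin m) (next : Q)
  /-- make an odd-one-out query on the point in cell `j` of the query tape -/
  | query (j : Fin m) (next : OddResponse d → Q)
  /-- write the bit `v` at position `b` of the work tape -/
  | write (b : Fin w) (v : Bool) (next : Q)
  /-- read the bit at position `b` of the work tape -/
  | read (b : Fin w) (next : Bool → Q)
  /-- test whether cells `j` and `k` of the query tape hold points `x`, `y` with `x i ≤ y i` -/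
  | compare (i : Fin d) (j k : Fin m) (next : Bool → Q)
  /-- stop -/
  | halt

/-- A streaming active learner in `ℝ^d` with bounded memory. The instruction executed next depends
on the control state and, in an arbitrary (non-uniform) way, on the contents of the sample counter
and of the query counter. At the end a classifier with values in `{0, 1, ⊥}` (`none` is `⊥`) is read
off from the two tapes. -/
structure Learner (d : ℕ) where
  /-- number of cells of the query tape -/
  cells : ℕ
  /-- number of bits of the work tape -/
  bits : ℕ
  /-- control states -/
  Control : Type
  [fintypeControl : Fintype Control]
  /-- initial control state -/
  start : Control
  /-- the program: control state, sample counter, query counter -/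
  program : Control → ℕ → ℕ → Instruction d cells bits Control
  /-- the classifier represented by the final contents of the tapes -/
  output : (Fin cells → Option (Fin d → ℝ)) → (Fin bits → Bool) → (Fin d → ℝ) → Option Bool

attribute [instance] Learner.fintypeControl

namespace Learner

/-- Configurations of a learner. The points queried so far (`asked`) are recorded for the adversary
only; the learner has no access to them. -/
structure Config {d : ℕ} (L : Learner d) where
  control : L.Control
  queryTape : Fin L.cells → Option (Fin d → ℝ)
  workTape : Fin L.bits → Bool
  /-- sample counter -/
  samples : ℕ
  /-- query counter -/
  queries : ℕ
  asked : ℕ → Fin d → ℝ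

/-- The initial configuration: empty tapes and both counters at zero. -/
def init {d : ℕ} (L : Learner d) : L.Config where
  control := L.start
  queryTape := fun _ => none
  workTape := fun _ => false
  samples := 0
  queries := 0
  asked := fun _ => 0

open Classical in
/-- One step of a run on the stream `ω 0, ω 1, …` of unlabeled points; `none` means that the learner
has halted (an attempt to query an empty cell halts as well). -/
noncomputable def step {d : ℕ} (L : Learner d) (adv : Adversary d) (ω : ℕ → Fin d → ℝ)
    (c : L.Config) : Option L.Config :=
  match L.program c.control c.samples c.queries with
  | .sample j next => some { c with
      control := next
      queryTape := Function.update c.queryTape j (some (ω c.samples))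
      samples := c.samples + 1 }
  | .erase j next => some { c with
      control := next
      queryTape := Function.update c.queryTape j none }
  | .copy j k next => some { c with
      control := next
      queryTape := Function.update c.queryTape k (c.queryTape j) }
  | .query j next => (c.queryTape j).map fun x => { c with
      control := next (adv c.queries c.asked x)
      queries := c.queries + 1
      asked := Function.update c.asked c.queries x }
  | .write b v next => some { c with
      control := next
      workTape := Function.update c.workTape b v }
  | .read b next => some { c with control := next (c.workTape b) }
  | .compare i j k next => some { c with
      control := next (decide (∃ x y, c.queryTape j = some x ∧ c.queryTape k = some y ∧ x i ≤ y i)) }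
  | .halt => none

/-- The configuration after `t` steps (a halted learner stays in its final configuration). -/
noncomputable def run {d : ℕ} (L : Learner d) (adv : Adversary d) (ω : ℕ → Fin d → ℝ) (t : ℕ) :
    L.Config :=
  (fun c => (L.step adv ω c).getD c)^[t] L.init

/-- The learner has halted after at most `t` steps. -/
def HaltedAt {d : ℕ} (L : Learner d) (adv : Adversary d) (ω : ℕ → Fin d → ℝ) (t : ℕ) : Prop :=
  L.step adv ω (L.run adv ω t) = none

open Classical in
/-- The classifier returned by the learner (everywhere `⊥` if the learner does not halt). -/
noncomputable def result {d : ℕ} (L : Learner d) (adv : Adversary d) (ω : ℕ → Fin d → ℝ) :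
    (Fin d → ℝ) → Option Bool :=
  if hh : ∃ t, L.HaltedAt adv ω t then
    L.output (L.run adv ω (Nat.find hh)).queryTape (L.run adv ω (Nat.find hh)).workTape
  else fun _ => none

/-- Memory: the number of cells of the query tape plus the number of bits of the work tape. The
control states are charged as well, one unit each, so that the control cannot serve as a hidden
store. -/
def memory {d : ℕ} (L : Learner d) : ℕ := L.cells + L.bits + Fintype.card L.Control

/-- On every stream, for every rectangle and against every valid adversary, the learner halts after
at most `T` steps and makes at most `q` queries. -/
def RunsWithin {d : ℕ} (L : Learner d) (q T : ℝ) : Prop :=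
  ∀ (h : Rectangle d) (adv : Adversary d), adv.IsValid h → ∀ ω : ℕ → Fin d → ℝ,
    ∃ t : ℕ, (t : ℝ) ≤ T ∧ L.HaltedAt adv ω t ∧ ((L.run adv ω t).queries : ℝ) ≤ q

/-- Reliable: a label that is output is never wrong. -/
def IsReliable {d : ℕ} (L : Learner d) : Prop :=
  ∀ (h : Rectangle d) (adv : Adversary d), adv.IsValid h → ∀ (ω : ℕ → Fin d → ℝ) (x : Fin d → ℝ),
    L.result adv ω x ≠ none → L.result adv ω x = some (h.label x)

/-- Probably useful: for every distribution `D` on `ℝ^d`, with probability more than `1 - δ` over an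
i.i.d. stream drawn from `D`, the set of points on which the learner abstains has `D`-measure at
most `ε`. -/
def IsProbablyUseful {d : ℕ} (L : Learner d) (ε δ : ℝ) : Prop :=
  ∀ (D : MeasureTheory.Measure (Fin d → ℝ)) [MeasureTheory.IsProbabilityMeasure D]
    (h : Rectangle d) (adv : Adversary d), adv.IsValid h → adv.IsMeasurable →
    MeasureTheory.Measure.infinitePi (fun _ : ℕ => D)
      {ω | ENNReal.ofReal ε < D {x | L.result adv ω x = none}} < ENNReal.ofReal δ

/-- The learner RPU-learns axis-aligned rectangles with parameters `ε`, `δ`. -/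
def IsRPULearner {d : ℕ} (L : Learner d) (ε δ : ℝ) : Prop :=
  L.IsProbablyUseful ε δ ∧ L.IsReliable

end Learner

/-! For each of the `n = 2d` directions (signed coordinates) the learner stores the extreme known
positive point and the extreme point answered in that direction, and it queries only points whose
label these do not settle. Reliability is then consistency of the stored bounds with the rectangle,
and memory is linear in `d`.

For usefulness, let `v` be the mass of the negative points not yet known to be negative, `w k` the
mass of the positive points beyond all known positives in direction `k`, and `a = v + ∑ k, w k`; the
unsure set has mass `u ≤ a`. An unsure negative point answered in direction `k` settles every
negative point at least as far out in that direction. The adversary picks `k`, but for at least half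
of the unsure negative mass all `n` upper tails have mass at least `v / (2n)`
(`le_measureReal_deepSet`). A positive answer cuts every `w k` whose set contains the point,
typically by half. By Cauchy-Schwarz, `a` drops by at least `a ^ 2 / (8n)` in the mean. Since `a`
can be of order `n`, one passes to `g = a / (1 + a) ≤ 1`, whose mean after one sample is at most `g
* (1 - u / (16n))` (`integral_normPotential_boxStep_le`). The bounded start of `g` keeps `log d` out
of the query bound.

This drift is used twice. A query occurs with probability `u`, so `g` rescaled by `1 - 1 / (16n)`
per query is a supermartingale: ending with `u > ε` and an exhausted budget `Q` is exponentially
unlikely in `Q / n`. While `u > ε` and budget remains, `g` contracts by `1 - ε / (16n)` per sample: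
ending so after `N` samples is exponentially unlikely in `ε N / n`. Markov's inequality gives both
(`measure_unsure_le`). The machine simulates this process at linear cost per sample
(`exists_reachesIn_draw`). -/

open MeasureTheory ProbabilityTheory Filter Topology Set
open scoped ENNReal

/-! ### Deterministic recursions driven by an i.i.d. stream -/

section Chain

variable {S E : Type*}

/-- The state of a deterministic process driven by the first `t` points of a stream. -/
def drivenChain (f : S → E → S) (s₀ : S) (ω : ℕ → E) : ℕ → S
  | 0 => s₀
  | t + 1 => f (drivenChain f s₀ ω t) (ω t)

theorem drivenChain_induction {f : S → E → S} {s₀ : S} {I : S → Prop} (h0 : I s₀)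
    (hI : ∀ s x, I s → I (f s x)) (ω : ℕ → E) (t : ℕ) : I (drivenChain f s₀ ω t) := by
  induction t with
  | zero => exact h0
  | succ t ih => exact hI _ _ ih

variable [MeasurableSpace S] [MeasurableSpace E]

theorem exists_drivenChain_eq_restrict {f : S → E → S} (hf : Measurable (Function.uncurry f))
    (s₀ : S) (t : ℕ) : ∃ G : (Finset.range t → E) → S, Measurable G ∧
      ∀ ω, drivenChain f s₀ ω t = G (fun i => ω i) := by
  induction t with
  | zero => exact ⟨fun _ => s₀, measurable_const, fun _ => rfl⟩
  | succ t ih =>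
    obtain ⟨G, hG, h⟩ := ih
    refine ⟨fun ω => f (G fun i => ω ⟨i, Finset.mem_range.2
      ((Finset.mem_range.1 i.2).trans (Nat.lt_succ_self t))⟩)
      (ω ⟨t, Finset.self_mem_range_succ t⟩), ?_, fun ω => ?_⟩
    · refine hf.comp (Measurable.prodMk (hG.comp ?_) (measurable_pi_apply _))
      exact measurable_pi_lambda _ fun i => measurable_pi_apply _
    · simp only [drivenChain, h]

theorem measurable_drivenChain {f : S → E → S} (hf : Measurable (Function.uncurry f))
    (s₀ : S) (t : ℕ) : Measurable fun ω => drivenChain f s₀ ω t := by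
  obtain ⟨G, hG, h⟩ := exists_drivenChain_eq_restrict hf s₀ t
  simp only [h]
  exact hG.comp (measurable_pi_lambda _ fun i => measurable_pi_apply _)

/-- The state at time `t` is a function of the points before `t`, hence independent of the point `ω
t`; the joint law is a product and Tonelli applies. -/
theorem lintegral_drivenChain_succ (D : Measure E) [IsProbabilityMeasure D] {f : S → E → S}
    (hf : Measurable (Function.uncurry f)) (s₀ : S) (t : ℕ) {g : S → ℝ≥0∞} (hg : Measurable g) :
    ∫⁻ ω, g (drivenChain f s₀ ω (t + 1)) ∂(Measure.infinitePi fun _ : ℕ => D) =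
      ∫⁻ ω, ∫⁻ x, g (f (drivenChain f s₀ ω t) x) ∂D ∂(Measure.infinitePi fun _ : ℕ => D) := by
  set P := Measure.infinitePi fun _ : ℕ => D
  have hm := measurable_drivenChain hf s₀ t
  have hind : IndepFun (fun ω : ℕ → E => drivenChain f s₀ ω t) (fun ω => ω t) P := by
    obtain ⟨G, hG, h⟩ := exists_drivenChain_eq_restrict hf s₀ t
    have hi : iIndepFun (fun (i : ℕ) (ω : ℕ → E) => ω i) P :=
      iIndepFun_infinitePi (X := fun _ x => x) fun _ => measurable_id
    have h2 := hi.indepFun_finset (Finset.range t) {t} (by simp) fun i => measurable_pi_apply i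
    have h3 := h2.comp hG (measurable_pi_apply ⟨t, Finset.mem_singleton_self t⟩)
    simp only [h]
    exact h3
  have hmap := (indepFun_iff_map_prod_eq_prod_map_map hm.aemeasurable
    (measurable_pi_apply t).aemeasurable).1 hind
  have hD : P.map (fun ω => ω t) = D := Measure.infinitePi_map_eval (fun _ : ℕ => D) t
  have hgf : Measurable fun p : S × E => g (f p.1 p.2) := hg.comp hf
  calc ∫⁻ ω, g (drivenChain f s₀ ω (t + 1)) ∂P
      = ∫⁻ p, g (f p.1 p.2) ∂(P.map fun ω => (drivenChain f s₀ ω t, ω t)) := by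
        rw [lintegral_map hgf (hm.prodMk (measurable_pi_apply t))]; rfl
    _ = ∫⁻ s, ∫⁻ x, g (f s x) ∂D ∂(P.map fun ω => drivenChain f s₀ ω t) := by
        rw [hmap, hD, lintegral_prod _ hgf.aemeasurable]
    _ = _ := by rw [lintegral_map hgf.lintegral_prod_right' hm]

/-- A potential that contracts by a factor `a` in expectation at each step. -/
theorem lintegral_drivenChain_le (D : Measure E) [IsProbabilityMeasure D] {f : S → E → S}
    (hf : Measurable (Function.uncurry f)) {s₀ : S} {I : S → Prop} (h0 : I s₀)
    (hI : ∀ s x, I s → I (f s x)) {g : S → ℝ≥0∞} (hg : Measurable g) (a : ℝ≥0∞)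
    (hstep : ∀ s, I s → ∫⁻ x, g (f s x) ∂D ≤ a * g s) (t : ℕ) :
    ∫⁻ ω, g (drivenChain f s₀ ω t) ∂(Measure.infinitePi fun _ : ℕ => D) ≤ a ^ t * g s₀ := by
  induction t with
  | zero => simp [drivenChain]
  | succ t ih =>
    rw [lintegral_drivenChain_succ D hf s₀ t hg]
    calc _ ≤ ∫⁻ ω, a * g (drivenChain f s₀ ω t) ∂(Measure.infinitePi fun _ : ℕ => D) :=
          lintegral_mono fun ω => hstep _ (drivenChain_induction h0 hI ω t)
      _ = a * ∫⁻ ω, g (drivenChain f s₀ ω t) ∂(Measure.infinitePi fun _ : ℕ => D) :=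
          lintegral_const_mul _ (hg.comp (measurable_drivenChain hf s₀ t))
      _ ≤ a * (a ^ t * g s₀) := by gcongr
      _ = a ^ (t + 1) * g s₀ := by ring

end Chain

/-! ### Upper tails evaluated at a random point -/

section UpperTail

variable {E : Type*} [MeasurableSpace E]

/-- The upper tail of a random variable at its own value is rarely small. -/
theorem measureReal_upperTail_lt_le (μ : Measure E) [IsFiniteMeasure μ] (f : E → EReal) {η : ℝ}
    (hη : 0 ≤ η) :
    μ.real {x | μ.real {y | f x ≤ f y} < η} ≤ η := by
  set T : Set EReal := {a | μ.real (f ⁻¹' Ici a) < η} with hT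
  have hup : ∀ a ∈ T, ∀ b, a ≤ b → b ∈ T := fun a ha b hab =>
    (measureReal_mono (preimage_mono (Ici_subset_Ici.2 hab))).trans_lt ha
  have hset : {x | μ.real {y | f x ≤ f y} < η} = f ⁻¹' T := rfl
  rw [hset]
  rcases T.eq_empty_or_nonempty with h0 | h0
  · simp [h0, hη]
  -- `T` is an up-set. If it contains its infimum it is a closed ray, whose mass is below `η` by
  -- membership; otherwise it is an increasing union of closed rays with endpoints in `T`, and the
  -- bound passes to the limit.
  by_cases hm : sInf T ∈ T
  · have : T = Ici (sInf T) := by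
      ext a; exact ⟨fun h => sInf_le h, fun h => hup _ hm _ h⟩
    rw [this]
    exact le_of_lt hm
  · obtain ⟨u, hu, hlim, huT⟩ := exists_seq_tendsto_sInf h0 (OrderBot.bddBelow T)
    have hTu : f ⁻¹' T = ⋃ n, f ⁻¹' Ici (u n) := by
      rw [← preimage_iUnion]
      congr 1
      ext a
      simp only [mem_iUnion, mem_Ici]
      refine ⟨fun ha => ?_, fun ⟨n, hn⟩ => hup _ (huT n) _ hn⟩
      have : sInf T < a := lt_of_le_of_ne (sInf_le ha) fun h => hm (h ▸ ha)
      exact ((hlim.eventually (eventually_lt_nhds this)).exists).imp fun n hn => hn.le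
    have hlimit := tendsto_measure_iUnion_atTop (μ := μ) (s := fun n => f ⁻¹' Ici (u n))
      fun m n hmn => preimage_mono (Ici_subset_Ici.2 (hu hmn))
    rw [← hTu] at hlimit
    have h2 := (ENNReal.tendsto_toReal (measure_ne_top μ _)).comp hlimit
    exact le_of_tendsto' h2 fun n => le_of_lt (huT n)

/-- Conditioned on `V`, the upper tail at a random point of `V` is rarely small. -/
theorem measureReal_inter_upperTail_lt_le (D : Measure E) [IsFiniteMeasure D] {V : Set E}
    (hV : MeasurableSet V) (f : E → EReal) {η : ℝ} (hη : 0 ≤ η) :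
    D.real {x | x ∈ V ∧ D.real {y | y ∈ V ∧ f x ≤ f y} < η} ≤ η := by
  have key := measureReal_upperTail_lt_le (D.restrict V) f hη
  have h1 : ∀ A : Set E, (D.restrict V).real A = D.real {y | y ∈ V ∧ y ∈ A} := fun A => by
    rw [measureReal_restrict_apply' hV]
    congr 1
    ext y
    simp [and_comm]
  simp only [h1] at key
  exact key

end UpperTail

/-! ### The abstract learner for a box given by finitely many upper bounds -/

section BoxLearner

variable {κ E : Type*}

/-- The knowledge of the learner: the largest signed coordinates of positive points, the smallest
signed coordinates of points answered by the respective direction, the number of queries and the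
points queried. -/
abbrev BoxState (κ E : Type*) : Type _ := (κ → EReal) × (κ → EReal) × ℕ × (ℕ → E)

/-- The points whose label is not implied by the knowledge of the learner. -/
def unsureSet (c : κ → E → EReal) (s : BoxState κ E) : Set E :=
  {x | (∀ k, c k x < s.2.1 k) ∧ ∃ k, s.1 k < c k x}

open Classical in
/-- Process the point `x`: a point with unknown label is queried if the budget `Q` allows it. -/
noncomputable def boxStep (Q : ℕ) (c : κ → E → EReal) (resp : ℕ → (ℕ → E) → E → Option κ)
    (s : BoxState κ E) (x : E) : BoxState κ E :=
  if s.2.2.1 < Q ∧ x ∈ unsureSet c s then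
    (fun k => if resp s.2.2.1 s.2.2.2 x = none then max (s.1 k) (c k x) else s.1 k,
      fun k => if resp s.2.2.1 s.2.2.2 x = some k then c k x else s.2.1 k,
      s.2.2.1 + 1, Function.update s.2.2.2 s.2.2.1 x)
  else s

/-- The responses are correct for the box `{x | ∀ k, c k x ≤ B k}`. -/
def IsCorrectResp (c : κ → E → EReal) (B : κ → EReal) (resp : ℕ → (ℕ → E) → E → Option κ) : Prop :=
  ∀ n past x, (resp n past x = none → ∀ k, c k x ≤ B k) ∧
    ∀ k, resp n past x = some k → B k < c k x

/-- The knowledge is consistent with the box `{x | ∀ k, c k x ≤ B k}`. -/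
def IsConsistent (c : κ → E → EReal) (B : κ → EReal) (s : BoxState κ E) : Prop :=
  (∀ k, s.1 k ≤ B k) ∧ ∀ k x, c k x ≤ B k → c k x < s.2.1 k

/-- The negative points that are not known to be negative. -/
def unsureNeg (c : κ → E → EReal) (B : κ → EReal) (s : BoxState κ E) : Set E :=
  {x | (∃ k, B k < c k x) ∧ ∀ k, c k x < s.2.1 k}

/-- The positive points beyond all known positive points in direction `k`. -/
def unsurePos (c : κ → E → EReal) (B : κ → EReal) (s : BoxState κ E) (k : κ) : Set E :=
  {x | (∀ j, c j x ≤ B j) ∧ s.1 k < c k x}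

variable {Q : ℕ} {c : κ → E → EReal} {B : κ → EReal} {resp : ℕ → (ℕ → E) → E → Option κ}
  {s : BoxState κ E} {x : E}

theorem boxStep_of_not (h : ¬(s.2.2.1 < Q ∧ x ∈ unsureSet c s)) : boxStep Q c resp s x = s :=
  if_neg h

theorem boxStep_of_none (h : s.2.2.1 < Q ∧ x ∈ unsureSet c s)
    (hr : resp s.2.2.1 s.2.2.2 x = none) : boxStep Q c resp s x =
      (fun k => max (s.1 k) (c k x), s.2.1, s.2.2.1 + 1, Function.update s.2.2.2 s.2.2.1 x) := by
  simp [boxStep, if_pos h, hr]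

open Classical in
theorem boxStep_of_some (h : s.2.2.1 < Q ∧ x ∈ unsureSet c s) {j : κ}
    (hr : resp s.2.2.1 s.2.2.2 x = some j) : boxStep Q c resp s x =
      (s.1, Function.update s.2.1 j (c j x), s.2.2.1 + 1,
        Function.update s.2.2.2 s.2.2.1 x) := by
  simp only [boxStep, if_pos h, hr, Prod.mk.injEq, and_true, reduceCtorEq, if_false, true_and]
  ext k
  by_cases hk : k = j
  · subst hk; simp
  · simp [hk, Ne.symm hk]

theorem IsConsistent.boxStep (hs : IsConsistent c B s) (hresp : IsCorrectResp c B resp) (x : E) :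
    IsConsistent c B (boxStep Q c resp s x) := by
  classical
  by_cases h : s.2.2.1 < Q ∧ x ∈ unsureSet c s
  · rcases hr : resp s.2.2.1 s.2.2.2 x with _ | j
    · rw [boxStep_of_none h hr]
      exact ⟨fun k => max_le (hs.1 k) ((hresp _ _ _).1 hr k), hs.2⟩
    · rw [boxStep_of_some h hr]
      refine ⟨hs.1, fun k y hy => ?_⟩
      by_cases hk : k = j
      · subst hk
        simpa using hy.trans_lt ((hresp _ _ _).2 _ hr)
      · simpa [hk] using hs.2 k y hy
  · rwa [boxStep_of_not h]

/-- Consistency gives both inclusions: positives never reach a negative bound, and negatives always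
exceed some positive bound. The sets `unsurePos` may overlap. -/
theorem unsureSet_eq (hs : IsConsistent c B s) :
    unsureSet c s = unsureNeg c B s ∪ ⋃ k, unsurePos c B s k := by
  ext x
  simp only [unsureSet, unsureNeg, unsurePos, mem_ofPred_eq, mem_union, mem_iUnion]
  constructor
  · rintro ⟨h1, k, hk⟩
    by_cases hp : ∀ j, c j x ≤ B j
    · exact Or.inr ⟨k, hp, hk⟩
    · push Not at hp
      exact Or.inl ⟨hp, h1⟩
  · rintro (⟨⟨k, hk⟩, h⟩ | ⟨k, h, hk⟩)
    · exact ⟨h, k, (hs.1 k).trans_lt hk⟩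
    · exact ⟨fun j => hs.2 j x (h j), k, hk⟩

theorem boxStep_le_fst (x : E) (k : κ) : s.1 k ≤ (boxStep Q c resp s x).1 k := by
  by_cases h : s.2.2.1 < Q ∧ x ∈ unsureSet c s
  · simp only [boxStep, if_pos h]
    split
    · exact le_max_left _ _
    · exact le_rfl
  · rw [boxStep_of_not h]

theorem boxStep_snd_le (x : E) (k : κ) : (boxStep Q c resp s x).2.1 k ≤ s.2.1 k := by
  by_cases h : s.2.2.1 < Q ∧ x ∈ unsureSet c s
  · simp only [boxStep, if_pos h]
    split
    · exact (h.2.1 k).le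
    · exact le_rfl
  · rw [boxStep_of_not h]

theorem boxStep_queries_ge (x : E) : s.2.2.1 ≤ (boxStep Q c resp s x).2.2.1 := by
  by_cases h : s.2.2.1 < Q ∧ x ∈ unsureSet c s
  · simp [boxStep, if_pos h]
  · rw [boxStep_of_not h]

theorem boxStep_queries_le (x : E) (hs : s.2.2.1 ≤ Q) : (boxStep Q c resp s x).2.2.1 ≤ Q := by
  by_cases h : s.2.2.1 < Q ∧ x ∈ unsureSet c s
  · simpa [boxStep, if_pos h] using h.1
  · rwa [boxStep_of_not h]

theorem unsureSet_boxStep_subset (x : E) : unsureSet c (boxStep Q c resp s x) ⊆ unsureSet c s :=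
  fun _ hy => ⟨fun k => (hy.1 k).trans_le (boxStep_snd_le x k),
    hy.2.imp fun k hk => (boxStep_le_fst x k).trans_lt hk⟩

theorem unsureNeg_boxStep_subset (x : E) :
    unsureNeg c B (boxStep Q c resp s x) ⊆ unsureNeg c B s :=
  fun _ hy => ⟨hy.1, fun k => (hy.2 k).trans_le (boxStep_snd_le x k)⟩

theorem unsurePos_boxStep_subset (x : E) (k : κ) :
    unsurePos c B (boxStep Q c resp s x) k ⊆ unsurePos c B s k :=
  fun _ hy => ⟨hy.1, (boxStep_le_fst x k).trans_lt hy.2⟩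

/-- The response must name a direction, and the bound in that direction becomes the coordinate of
`x`. Which direction it is depends on the adversary, hence the existential. -/
theorem exists_unsureNeg_boxStep_lt (hs : IsConsistent c B s) (hresp : IsCorrectResp c B resp)
    (hq : s.2.2.1 < Q) (hx : x ∈ unsureNeg c B s) :
    ∃ k, ∀ y ∈ unsureNeg c B (boxStep Q c resp s x), c k y < c k x := by
  classical
  have hU : x ∈ unsureSet c s := by rw [unsureSet_eq hs]; exact Or.inl hx
  rcases hr : resp s.2.2.1 s.2.2.2 x with _ | j
  · obtain ⟨k, hk⟩ := hx.1
    exact absurd ((hresp _ _ _).1 hr k) (not_le.2 hk)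
  · refine ⟨j, fun y hy => ?_⟩
    have := hy.2 j
    rw [boxStep_of_some ⟨hq, hU⟩ hr] at this
    simpa using this

/-- On a positive point the response is forced, so a single query raises the positive bounds in all
directions and the adversary has no influence. -/
theorem unsurePos_boxStep_lt (hs : IsConsistent c B s) (hresp : IsCorrectResp c B resp)
    (hq : s.2.2.1 < Q) {k : κ} (hx : x ∈ unsurePos c B s k) :
    ∀ y ∈ unsurePos c B (boxStep Q c resp s x) k, c k x < c k y := by
  have hU : x ∈ unsureSet c s := by
    rw [unsureSet_eq hs]; exact Or.inr (mem_iUnion.2 ⟨k, hx⟩)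
  rcases hr : resp s.2.2.1 s.2.2.2 x with _ | j
  · intro y hy
    have := hy.2
    rw [boxStep_of_none ⟨hq, hU⟩ hr] at this
    exact (max_lt_iff.1 this).2
  · exact absurd (hx.1 j) (not_le.2 ((hresp _ _ _).2 j hr))

variable [MeasurableSpace E] [Fintype κ]

/-- The potential of the knowledge `s`. -/
noncomputable def boxPotential (D : Measure E) (c : κ → E → EReal) (B : κ → EReal)
    (s : BoxState κ E) : ℝ :=
  D.real (unsureNeg c B s) + ∑ k, D.real (unsurePos c B s k)

/-! ### Measurability of the potential and of the update -/

section Measurability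

theorem measurableSet_setOf_unsureSet (hc : ∀ k, Measurable (c k)) :
    MeasurableSet {p : BoxState κ E × E | p.2 ∈ unsureSet c p.1} := by
  have : {p : BoxState κ E × E | p.2 ∈ unsureSet c p.1} =
      (⋂ k, {p | c k p.2 < p.1.2.1 k}) ∩ ⋃ k, {p | p.1.1 k < c k p.2} := by
    ext p; simp [unsureSet]
  rw [this]
  refine .inter (.iInter fun k => measurableSet_lt ((hc k).comp measurable_snd) ?_)
    (.iUnion fun k => measurableSet_lt ?_ ((hc k).comp measurable_snd))
  · exact (measurable_pi_apply k).comp (measurable_fst.comp (measurable_snd.comp measurable_fst))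
  · exact (measurable_pi_apply k).comp (measurable_fst.comp measurable_fst)

theorem measurableSet_setOf_unsureNeg (hc : ∀ k, Measurable (c k)) :
    MeasurableSet {p : BoxState κ E × E | p.2 ∈ unsureNeg c B p.1} := by
  have : {p : BoxState κ E × E | p.2 ∈ unsureNeg c B p.1} =
      (⋃ k, {p | B k < c k p.2}) ∩ ⋂ k, {p | c k p.2 < p.1.2.1 k} := by
    ext p; simp [unsureNeg]
  rw [this]
  refine .inter (.iUnion fun k => measurableSet_lt measurable_const ((hc k).comp measurable_snd))
    (.iInter fun k => measurableSet_lt ((hc k).comp measurable_snd) ?_)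
  exact (measurable_pi_apply k).comp (measurable_fst.comp (measurable_snd.comp measurable_fst))

theorem measurableSet_setOf_unsurePos (hc : ∀ k, Measurable (c k)) (k : κ) :
    MeasurableSet {p : BoxState κ E × E | p.2 ∈ unsurePos c B p.1 k} := by
  have : {p : BoxState κ E × E | p.2 ∈ unsurePos c B p.1 k} =
      (⋂ j, {p | c j p.2 ≤ B j}) ∩ {p | p.1.1 k < c k p.2} := by
    ext p; simp [unsurePos]
  rw [this]
  refine .inter (.iInter fun k => measurableSet_le ((hc k).comp measurable_snd) measurable_const)
    (measurableSet_lt ?_ ((hc k).comp measurable_snd))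
  exact (measurable_pi_apply k).comp (measurable_fst.comp measurable_fst)

theorem measurable_measureReal_section {S : Type*} [MeasurableSpace S] (D : Measure E)
    [IsFiniteMeasure D] {A : S → Set E} (hA : MeasurableSet {p : S × E | p.2 ∈ A p.1}) :
    Measurable fun s => D.real (A s) :=
  (measurable_measure_prodMk_left hA).ennreal_toReal

theorem measurable_boxPotential (D : Measure E) [IsFiniteMeasure D]
    (hc : ∀ k, Measurable (c k)) : Measurable (boxPotential D c B) :=
  (measurable_measureReal_section D (measurableSet_setOf_unsureNeg hc)).add
    (Finset.measurable_fun_sum _ fun k _ =>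
      measurable_measureReal_section D (measurableSet_setOf_unsurePos hc k))

theorem measurable_boxStep (hc : ∀ k, Measurable (c k))
    (hresp : ∀ n r, MeasurableSet {p : (ℕ → E) × E | resp n p.1 p.2 = r}) :
    Measurable (Function.uncurry (boxStep Q c resp)) := by
  classical
  have hq : Measurable fun p : BoxState κ E × E => p.1.2.2.1 :=
    measurable_fst.comp (measurable_snd.comp (measurable_snd.comp measurable_fst))
  have hasked : Measurable fun p : BoxState κ E × E => p.1.2.2.2 :=
    measurable_snd.comp (measurable_snd.comp (measurable_snd.comp measurable_fst))
  have hr : ∀ r, MeasurableSet {p : BoxState κ E × E | resp p.1.2.2.1 p.1.2.2.2 p.2 = r} := by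
    intro r
    -- The query index is itself random but takes countably many values, so the event splits along
    -- it and measurability for each fixed index suffices.
    have : {p : BoxState κ E × E | resp p.1.2.2.1 p.1.2.2.2 p.2 = r} =
        ⋃ n, {p | p.1.2.2.1 = n} ∩ (fun p : BoxState κ E × E => (p.1.2.2.2, p.2)) ⁻¹'
          {p : (ℕ → E) × E | resp n p.1 p.2 = r} := by
      ext p; simp
    rw [this]
    exact .iUnion fun n => (hq (measurableSet_singleton n)).inter
      ((hasked.prodMk measurable_snd) (hresp n r))
  have h1 : ∀ k, Measurable fun p : BoxState κ E × E => p.1.1 k := fun k =>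
    (measurable_pi_apply k).comp (measurable_fst.comp measurable_fst)
  have h2 : ∀ k, Measurable fun p : BoxState κ E × E => p.1.2.1 k := fun k =>
    (measurable_pi_apply k).comp (measurable_fst.comp (measurable_snd.comp measurable_fst))
  have hck : ∀ k, Measurable fun p : BoxState κ E × E => c k p.2 := fun k =>
    (hc k).comp measurable_snd
  unfold boxStep Function.uncurry
  refine Measurable.ite ?_ (Measurable.prodMk ?_ (Measurable.prodMk ?_ (Measurable.prodMk ?_ ?_)))
    measurable_fst
  · exact (hq measurableSet_Iio).inter (measurableSet_setOf_unsureSet hc)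
  · exact measurable_pi_lambda _ fun k => Measurable.ite (hr none) ((h1 k).max (hck k)) (h1 k)
  · exact measurable_pi_lambda _ fun k => Measurable.ite (hr (some k)) (hck k) (h2 k)
  · exact hq.add_const 1
  · refine measurable_pi_lambda _ fun j => ?_
    simp only [Function.update_apply]
    exact Measurable.ite (hq.eq_const j |> fun h => by simpa [eq_comm] using h) measurable_snd
      ((measurable_pi_apply j).comp hasked)

end Measurability

end BoxLearner

/-! ### Expected decrease of the potential -/

section Drift

variable {κ E : Type*} {Q : ℕ} {c : κ → E → EReal} {B : κ → EReal}
  {resp : ℕ → (ℕ → E) → E → Option κ} {s : BoxState κ E} [MeasurableSpace E] [Fintype κ]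

theorem measurableSet_unsureSet (hc : ∀ k, Measurable (c k)) (s : BoxState κ E) :
    MeasurableSet (unsureSet c s) :=
  measurable_prodMk_left (x := s) (measurableSet_setOf_unsureSet hc)

theorem measurableSet_unsureNeg (hc : ∀ k, Measurable (c k)) (s : BoxState κ E) :
    MeasurableSet (unsureNeg c B s) :=
  measurable_prodMk_left (x := s) (measurableSet_setOf_unsureNeg hc)

theorem measurableSet_unsurePos (hc : ∀ k, Measurable (c k)) (s : BoxState κ E) (k : κ) :
    MeasurableSet (unsurePos c B s k) :=
  measurable_prodMk_left (x := s) (measurableSet_setOf_unsurePos hc k)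

theorem measureReal_unsureSet_le_boxPotential (D : Measure E) [IsFiniteMeasure D]
    (hs : IsConsistent c B s) : D.real (unsureSet c s) ≤ boxPotential D c B s := by
  rw [unsureSet_eq hs]
  exact (measureReal_union_le _ _).trans
    (add_le_add le_rfl (measureReal_iUnion_fintype_le _))

/-- The points of `V` at whose value all upper tails of `V` have measure at least `η`. -/
def deepSet (D : Measure E) (V : Set E) (c : κ → E → EReal) (η : ℝ) : Set E :=
  {x | x ∈ V ∧ ∀ k, η ≤ D.real {y | y ∈ V ∧ c k x ≤ c k y}}

theorem measurable_measureReal_upperTail (D : Measure E) [IsFiniteMeasure D] {V : Set E}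
    (hV : MeasurableSet V) {f : E → EReal} (hf : Measurable f) :
    Measurable fun x => D.real {y | y ∈ V ∧ f x ≤ f y} :=
  measurable_measureReal_section D (A := fun x => {y | y ∈ V ∧ f x ≤ f y})
    ((measurable_snd hV).inter (measurableSet_le (hf.comp measurable_fst) (hf.comp measurable_snd)))

theorem measurableSet_deepSet (D : Measure E) [IsFiniteMeasure D] {V : Set E}
    (hV : MeasurableSet V) (hc : ∀ k, Measurable (c k)) (η : ℝ) :
    MeasurableSet (deepSet D V c η) := by
  have : deepSet D V c η = V ∩ ⋂ k, {x | η ≤ D.real {y | y ∈ V ∧ c k x ≤ c k y}} := by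
    ext; simp [deepSet]
  rw [this]
  exact hV.inter (.iInter fun k =>
    measurableSet_le measurable_const (measurable_measureReal_upperTail D hV (hc k)))

/-- Union bound: each direction spoils a set of mass at most `η`. -/
theorem le_measureReal_deepSet (D : Measure E) [IsFiniteMeasure D] {V : Set E}
    (hV : MeasurableSet V) (c : κ → E → EReal) {η : ℝ} (hη : 0 ≤ η) :
    D.real V - Fintype.card κ * η ≤ D.real (deepSet D V c η) := by
  have hsub : V ⊆ deepSet D V c η ∪
      ⋃ k, {x | x ∈ V ∧ D.real {y | y ∈ V ∧ c k x ≤ c k y} < η} := by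
    intro x hx
    by_cases h : ∀ k, η ≤ D.real {y | y ∈ V ∧ c k x ≤ c k y}
    · exact Or.inl ⟨hx, h⟩
    · push Not at h
      obtain ⟨k, hk⟩ := h
      exact Or.inr (mem_iUnion.2 ⟨k, hx, hk⟩)
  have h1 : D.real V ≤ D.real (deepSet D V c η) +
      ∑ k, D.real {x | x ∈ V ∧ D.real {y | y ∈ V ∧ c k x ≤ c k y} < η} :=
    (measureReal_mono hsub).trans <| (measureReal_union_le _ _).trans
      (add_le_add le_rfl (measureReal_iUnion_fintype_le _))
  have h2 : ∑ k, D.real {x | x ∈ V ∧ D.real {y | y ∈ V ∧ c k x ≤ c k y} < η} ≤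
      ∑ _k : κ, η :=
    Finset.sum_le_sum fun k _ => measureReal_inter_upperTail_lt_le D hV (c k) hη
  simp only [Finset.sum_const, Finset.card_univ, nsmul_eq_mul] at h2
  linarith

/-- At a deep point every upper tail has mass at least `η`, so at least `η` is removed whichever
direction the adversary names. -/
theorem measureReal_unsureNeg_boxStep_add_le (D : Measure E) [IsFiniteMeasure D]
    (hc : ∀ k, Measurable (c k)) (hs : IsConsistent c B s) (hresp : IsCorrectResp c B resp)
    (hq : s.2.2.1 < Q) (η : ℝ) (x : E) :
    D.real (unsureNeg c B (boxStep Q c resp s x)) +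
      (deepSet D (unsureNeg c B s) c η).indicator (fun _ => η) x ≤ D.real (unsureNeg c B s) := by
  by_cases hx : x ∈ deepSet D (unsureNeg c B s) c η
  · rw [indicator_of_mem hx]
    obtain ⟨k, hk⟩ := exists_unsureNeg_boxStep_lt hs hresp hq hx.1
    have hmeas : MeasurableSet {y | y ∈ unsureNeg c B s ∧ c k x ≤ c k y} :=
      (measurableSet_unsureNeg hc s).inter (measurableSet_le measurable_const (hc k))
    have hd : Disjoint (unsureNeg c B (boxStep Q c resp s x))
        {y | y ∈ unsureNeg c B s ∧ c k x ≤ c k y} :=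
      Set.disjoint_left.2 fun y hy hy' => absurd hy'.2 (not_le.2 (hk y hy))
    have := measureReal_mono (μ := D) (union_subset
      (unsureNeg_boxStep_subset (c := c) (B := B) (s := s) (Q := Q) (resp := resp) x)
      (fun y hy => hy.1 : {y | y ∈ unsureNeg c B s ∧ c k x ≤ c k y} ⊆ unsureNeg c B s))
    rw [measureReal_union hd hmeas] at this
    linarith [hx.2 k]
  · rw [indicator_of_notMem hx, add_zero]
    exact measureReal_mono (unsureNeg_boxStep_subset x)

/-- What a positive answer removes is the lower tail in direction `k`, an upper tail of `-c k`. Only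
this one function matters, hence the index type `Unit`. -/
theorem measureReal_unsurePos_boxStep_add_le (D : Measure E) [IsFiniteMeasure D]
    (hc : ∀ k, Measurable (c k)) (hs : IsConsistent c B s) (hresp : IsCorrectResp c B resp)
    (hq : s.2.2.1 < Q) (k : κ) (η : ℝ) (x : E) :
    D.real (unsurePos c B (boxStep Q c resp s x) k) +
      (deepSet D (unsurePos c B s k) (fun _ : Unit => fun y => -c k y) η).indicator (fun _ => η) x ≤
        D.real (unsurePos c B s k) := by
  by_cases hx : x ∈ deepSet D (unsurePos c B s k) (fun _ : Unit => fun y => -c k y) η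
  · rw [indicator_of_mem hx]
    have hk := unsurePos_boxStep_lt hs hresp hq hx.1
    have hη := hx.2 ()
    simp only [EReal.neg_le_neg_iff] at hη
    have hmeas : MeasurableSet {y | y ∈ unsurePos c B s k ∧ c k y ≤ c k x} :=
      (measurableSet_unsurePos hc s k).inter (measurableSet_le (hc k) measurable_const)
    have hd : Disjoint (unsurePos c B (boxStep Q c resp s x) k)
        {y | y ∈ unsurePos c B s k ∧ c k y ≤ c k x} :=
      Set.disjoint_left.2 fun y hy hy' => absurd hy'.2 (not_le.2 (hk y hy))
    have := measureReal_mono (μ := D) (union_subset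
      (unsurePos_boxStep_subset (c := c) (B := B) (s := s) (Q := Q) (resp := resp) x k)
      (fun y hy => hy.1 : {y | y ∈ unsurePos c B s k ∧ c k y ≤ c k x} ⊆ unsurePos c B s k))
    rw [measureReal_union hd hmeas] at this
    linarith
  · rw [indicator_of_notMem hx, add_zero]
    exact measureReal_mono (unsurePos_boxStep_subset x k)

theorem boxPotential_nonneg (D : Measure E) (s : BoxState κ E) : 0 ≤ boxPotential D c B s :=
  add_nonneg measureReal_nonneg (Finset.sum_nonneg fun _ _ => measureReal_nonneg)

theorem div_one_add_le_one {a : ℝ} (ha : 0 ≤ a) : a / (1 + a) ≤ 1 := by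
  rw [div_le_one (by linarith)]; linarith

/-- A decrease of the potential by `b` decreases the normalized potential by `b / (1 + a) ^ 2`. -/
theorem div_one_add_add_le {a a' b : ℝ} (ha' : 0 ≤ a') (hb : 0 ≤ b) (h : a' + b ≤ a) :
    a' / (1 + a') + b / (1 + a) ^ 2 ≤ a / (1 + a) := by
  have h1 : 0 < 1 + a' := by linarith
  have h2 : 0 < 1 + a := by linarith
  have h3 : a / (1 + a) - a' / (1 + a') = (a - a') / ((1 + a) * (1 + a')) := by
    field_simp; ring
  have h4 : b / (1 + a) ^ 2 ≤ (a - a') / ((1 + a) * (1 + a')) := by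
    apply div_le_div₀ (by linarith) (by linarith) (by positivity)
    rw [pow_two]
    exact mul_le_mul_of_nonneg_left (by linarith) h2.le
  linarith

/-- The normalized potential. -/
noncomputable def normPotential (D : Measure E) (c : κ → E → EReal) (B : κ → EReal)
    (s : BoxState κ E) : ℝ :=
  boxPotential D c B s / (1 + boxPotential D c B s)

theorem normPotential_nonneg (D : Measure E) (s : BoxState κ E) : 0 ≤ normPotential D c B s :=
  div_nonneg (boxPotential_nonneg D s) (by linarith [boxPotential_nonneg (c := c) (B := B) D s])

theorem normPotential_le_one (D : Measure E) (s : BoxState κ E) : normPotential D c B s ≤ 1 :=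
  div_one_add_le_one (boxPotential_nonneg D s)

theorem measurable_normPotential (D : Measure E) [IsFiniteMeasure D]
    (hc : ∀ k, Measurable (c k)) : Measurable (normPotential D c B) :=
  (measurable_boxPotential D hc).div ((measurable_boxPotential D hc).const_add 1)

theorem integrable_of_mem_Icc (D : Measure E) [IsFiniteMeasure D] {f : E → ℝ}
    (hf : Measurable f) (h0 : ∀ x, 0 ≤ f x) (h1 : ∀ x, f x ≤ 1) : Integrable f D :=
  .of_bound hf.aestronglyMeasurable 1 (.of_forall fun x => by
    rw [Real.norm_of_nonneg (h0 x)]; exact h1 x)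

theorem integral_normPotential_boxStep_le (D : Measure E) [IsProbabilityMeasure D]
    (hc : ∀ k, Measurable (c k))
    (hmeas : ∀ n r, MeasurableSet {p : (ℕ → E) × E | resp n p.1 p.2 = r})
    (hκ : 0 < Fintype.card κ)
    (hs : IsConsistent c B s) (hresp : IsCorrectResp c B resp) (hq : s.2.2.1 < Q) :
    ∫ x, normPotential D c B (boxStep Q c resp s x) ∂D ≤
      normPotential D c B s * (1 - D.real (unsureSet c s) / (16 * Fintype.card κ)) := by
  set n : ℝ := (Fintype.card κ : ℝ) with hn
  have hn1 : 1 ≤ n := by rw [hn]; exact_mod_cast hκ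
  set v := D.real (unsureNeg c B s) with hv
  set w : κ → ℝ := fun k => D.real (unsurePos c B s k) with hw
  set a := boxPotential D c B s with ha
  have ha_eq : a = v + ∑ k, w k := rfl
  have hv0 : 0 ≤ v := measureReal_nonneg
  have hw0 : ∀ k, 0 ≤ w k := fun k => measureReal_nonneg
  have ha0 : 0 ≤ a := boxPotential_nonneg D s
  -- With threshold `v / (2n)` the `n` directions spoil at most half of `v`; for the positives only
  -- one function counts, so `w k / 2` suffices.
  set A := deepSet D (unsureNeg c B s) c (v / (2 * n)) with hA
  set A' : κ → Set E := fun k =>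
    deepSet D (unsurePos c B s k) (fun _ : Unit => fun y => -c k y) (w k / 2) with hA'
  have hAm : MeasurableSet A := measurableSet_deepSet D (measurableSet_unsureNeg hc s) hc _
  have hAm' : ∀ k, MeasurableSet (A' k) := fun k =>
    measurableSet_deepSet D (measurableSet_unsurePos hc s k) (fun _ => (hc k).neg) _
  set dec : E → ℝ := fun x => A.indicator (fun _ => v / (2 * n)) x +
    ∑ k, (A' k).indicator (fun _ => w k / 2) x with hdec
  have hdec0 : ∀ x, 0 ≤ dec x := fun x => add_nonneg
    (indicator_nonneg (fun _ _ => by positivity) x)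
    (Finset.sum_nonneg fun k _ => indicator_nonneg (fun _ _ => by linarith [hw0 k]) x)
  have hpt : ∀ x, boxPotential D c B (boxStep Q c resp s x) + dec x ≤ a := fun x => by
    have h1 := measureReal_unsureNeg_boxStep_add_le D hc hs hresp hq (v / (2 * n)) x
    have h2 := Finset.sum_le_sum fun k (_ : k ∈ Finset.univ) =>
      measureReal_unsurePos_boxStep_add_le D hc hs hresp hq k (w k / 2) x
    rw [Finset.sum_add_distrib] at h2
    simp only [boxPotential, hdec, ha_eq]
    linarith
  have hpt' : ∀ x, normPotential D c B (boxStep Q c resp s x) + dec x / (1 + a) ^ 2 ≤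
      normPotential D c B s := fun x =>
    div_one_add_add_le (boxPotential_nonneg D _) (hdec0 x) (hpt x)
  have hint1 : Integrable (fun x => normPotential D c B (boxStep Q c resp s x)) D :=
    integrable_of_mem_Icc D ((measurable_normPotential D hc).comp
      ((measurable_boxStep hc hmeas).comp measurable_prodMk_left))
      (fun _ => normPotential_nonneg D _) (fun _ => normPotential_le_one D _)
  have hi1 : Integrable (A.indicator fun _ => v / (2 * n)) D :=
    (integrable_const _).indicator hAm
  have hi2 : ∀ k, Integrable ((A' k).indicator fun _ => w k / 2) D := fun k =>
    (integrable_const _).indicator (hAm' k)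
  have hi3 : Integrable (fun x => ∑ k, (A' k).indicator (fun _ => w k / 2) x) D :=
    integrable_finsetSum _ fun k _ => hi2 k
  have hint2 : Integrable dec D := hi1.add hi3
  have hdecint : ∫ x, dec x ∂D = D.real A * (v / (2 * n)) + ∑ k, D.real (A' k) * (w k / 2) := by
    rw [hdec, integral_add hi1 hi3, integral_finsetSum _ fun k _ => hi2 k,
      integral_indicator_const _ hAm]
    simp only [integral_indicator_const _ (hAm' _), smul_eq_mul]
  have hAge : v / 2 ≤ D.real A := by
    have := le_measureReal_deepSet D (measurableSet_unsureNeg (B := B) hc s) c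
      (η := v / (2 * n)) (by positivity)
    have h2 : n * (v / (2 * n)) = v / 2 := by field_simp
    rw [← hn, h2] at this
    linarith
  have hAge' : ∀ k, w k / 2 ≤ D.real (A' k) := fun k => by
    have := le_measureReal_deepSet D (measurableSet_unsurePos (B := B) hc s k)
      (fun _ : Unit => fun y => -c k y) (η := w k / 2) (by linarith [hw0 k])
    simp only [Fintype.card_unit, Nat.cast_one, one_mul] at this
    have h3 : w k = D.real (unsurePos c B s k) := rfl
    linarith
  -- Cauchy-Schwarz loses a factor `n` on the positives, matching the factor lost to the adversary
  -- on the negatives.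
  have hcs : (∑ k, w k) ^ 2 ≤ n * ∑ k, w k ^ 2 := by
    simpa [hn] using sq_sum_le_card_mul_sum_sq (s := (Finset.univ : Finset κ)) (f := w)
  have hdecge : a ^ 2 / (8 * n) ≤ ∫ x, dec x ∂D := by
    rw [hdecint]
    have h1 : v / 2 * (v / (2 * n)) ≤ D.real A * (v / (2 * n)) :=
      mul_le_mul_of_nonneg_right hAge (by positivity)
    have h2 : ∑ k, w k ^ 2 / 4 ≤ ∑ k, D.real (A' k) * (w k / 2) :=
      Finset.sum_le_sum fun k _ => by nlinarith [hAge' k, hw0 k]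
    rw [← Finset.sum_div] at h2
    have h3 : a ^ 2 ≤ 2 * v ^ 2 + 2 * (n * ∑ k, w k ^ 2) := by
      rw [ha_eq]; nlinarith [sq_nonneg (v - ∑ k, w k)]
    have h4 : a ^ 2 / (8 * n) ≤ v / 2 * (v / (2 * n)) + (∑ k, w k ^ 2) / 4 := by
      rw [div_le_iff₀ (by positivity)]
      have : (v / 2 * (v / (2 * n)) + (∑ k, w k ^ 2) / 4) * (8 * n) =
        2 * v ^ 2 + 2 * (n * ∑ k, w k ^ 2) := by field_simp; ring
      rw [this]; exact h3
    linarith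
  have hmain : ∫ x, normPotential D c B (boxStep Q c resp s x) ∂D +
      (∫ x, dec x ∂D) / (1 + a) ^ 2 ≤ normPotential D c B s := by
    rw [← integral_div, ← integral_add hint1 (hint2.div_const _)]
    calc _ ≤ ∫ _x, normPotential D c B s ∂D :=
          integral_mono (hint1.add (hint2.div_const _)) (integrable_const _) hpt'
      _ = _ := by simp
  have hu := measureReal_unsureSet_le_boxPotential D hs
  have hu1 : D.real (unsureSet c s) ≤ 1 := measureReal_le_one
  rw [← ha] at hu
  have hfin : normPotential D c B s * (D.real (unsureSet c s) / (16 * n)) ≤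
      (∫ x, dec x ∂D) / (1 + a) ^ 2 := by
    have hpos : 0 < 1 + a := by linarith
    calc a / (1 + a) * (D.real (unsureSet c s) / (16 * n))
        ≤ a ^ 2 / (8 * n) / (1 + a) ^ 2 := by
          rw [div_mul_div_comm, div_div, div_le_div_iff₀ (by positivity) (by positivity)]
          -- The unsure mass is bounded both by `a` and by `1`; this turns `a / (1 + a)` into at
          -- least half the unsure mass.
          have : D.real (unsureSet c s) * (1 + a) ≤ 2 * a := by nlinarith
          calc _ = (D.real (unsureSet c s) * (1 + a)) * (a * (8 * n * (1 + a))) := by ring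
            _ ≤ (2 * a) * (a * (8 * n * (1 + a))) := by gcongr
            _ = _ := by ring
      _ ≤ _ := by gcongr
  linarith

end Drift

/-! ### Supermartingales and the failure probability -/

section Tail

variable {κ E : Type*} {Q : ℕ} {c : κ → E → EReal} {B : κ → EReal}
  {resp : ℕ → (ℕ → E) → E → Option κ} {s : BoxState κ E} [MeasurableSpace E] [Fintype κ]

theorem integrable_normPotential_boxStep (D : Measure E) [IsFiniteMeasure D]
    (hc : ∀ k, Measurable (c k))
    (hmeas : ∀ n r, MeasurableSet {p : (ℕ → E) × E | resp n p.1 p.2 = r}) (s : BoxState κ E) :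
    Integrable (fun x => normPotential D c B (boxStep Q c resp s x)) D :=
  integrable_of_mem_Icc D ((measurable_normPotential D hc).comp
    ((measurable_boxStep hc hmeas).comp measurable_prodMk_left))
    (fun _ => normPotential_nonneg D _) (fun _ => normPotential_le_one D _)

/-- The potential, rescaled at each query, is a supermartingale. -/
theorem lintegral_normPotential_mul_le (D : Measure E) [IsProbabilityMeasure D]
    (hc : ∀ k, Measurable (c k))
    (hmeas : ∀ n r, MeasurableSet {p : (ℕ → E) × E | resp n p.1 p.2 = r})
    (hκ : 0 < Fintype.card κ) (hs : IsConsistent c B s) (hresp : IsCorrectResp c B resp)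
    {r : ℝ} (hr : r = 1 - 1 / (16 * Fintype.card κ)) :
    ∫⁻ x, ENNReal.ofReal (normPotential D c B (boxStep Q c resp s x) *
        (r ^ (boxStep Q c resp s x).2.2.1)⁻¹) ∂D ≤
      ENNReal.ofReal (normPotential D c B s * (r ^ s.2.2.1)⁻¹) := by
  have hn1 : (1 : ℝ) ≤ Fintype.card κ := by exact_mod_cast hκ
  have hr0 : 0 < r := by
    rw [hr, sub_pos, div_lt_one (by linarith)]; linarith
  by_cases hq : s.2.2.1 < Q
  · have hU := measurableSet_unsureSet hc s
    set R : ℝ := (r ^ (s.2.2.1 + 1))⁻¹ with hR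
    have hR0 : 0 < R := by positivity
    have hRr : (r ^ s.2.2.1)⁻¹ = R * r := by rw [hR, pow_succ]; field_simp
    set g := normPotential D c B s with hg
    have hg0 : 0 ≤ g := normPotential_nonneg D s
    -- Outside the unsure set nothing is queried, so the weight stays `R * r`; the indicator term
    -- records this while `R` is factored out.
    have hpt : ∀ x, normPotential D c B (boxStep Q c resp s x) *
        (r ^ (boxStep Q c resp s x).2.2.1)⁻¹ =
        R * (normPotential D c B (boxStep Q c resp s x) -
          (unsureSet c s)ᶜ.indicator (fun _ => (1 - r) * g) x) := fun x => by
      by_cases hx : x ∈ unsureSet c s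
      · have hqs : (boxStep Q c resp s x).2.2.1 = s.2.2.1 + 1 := by
          simp [boxStep, if_pos (And.intro hq hx)]
        rw [hqs, indicator_of_notMem (by simpa using hx), sub_zero, mul_comm]
      · rw [boxStep_of_not fun h => hx h.2, indicator_of_mem (by simpa using hx), hRr, ← hg]
        ring
    have hi1 := integrable_normPotential_boxStep (Q := Q) (B := B) D hc hmeas s
    have hi2 : Integrable ((unsureSet c s)ᶜ.indicator fun _ => (1 - r) * g) D :=
      (integrable_const _).indicator hU.compl
    have hnn : ∀ x, 0 ≤ normPotential D c B (boxStep Q c resp s x) *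
        (r ^ (boxStep Q c resp s x).2.2.1)⁻¹ := fun x =>
      mul_nonneg (normPotential_nonneg D _) (by positivity)
    rw [← ofReal_integral_eq_lintegral_ofReal]
    · apply ENNReal.ofReal_le_ofReal
      simp only [hpt]
      rw [integral_const_mul, integral_sub hi1 hi2, integral_indicator_const _ hU.compl,
        probReal_compl_eq_one_sub hU, hRr]
      have := integral_normPotential_boxStep_le D hc hmeas hκ hs hresp hq
      rw [← hg] at this
      -- With `u` the unsure mass, the drift bound is `g * (1 - u * (1 - r))`; subtracting `(1 - u)
      -- * (1 - r) * g` leaves `r * g`, whatever `u` is.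
      have hkey : ∫ x, normPotential D c B (boxStep Q c resp s x) ∂D -
          (1 - D.real (unsureSet c s)) • ((1 - r) * g) ≤ r * g := by
        refine (sub_le_sub_right this _).trans (le_of_eq ?_)
        rw [smul_eq_mul, hr]
        ring
      calc _ ≤ R * (r * g) := mul_le_mul_of_nonneg_left hkey hR0.le
        _ = _ := by ring
    · simp only [hpt]
      exact (hi1.sub hi2).const_mul R
    · exact .of_forall hnn
  · have : ∀ x, boxStep Q c resp s x = s := fun x => boxStep_of_not fun h => hq h.1
    simp [this]

open Classical in
/-- The potential while the learner is still uncertain and may query. -/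
noncomputable def activePotential (D : Measure E) (c : κ → E → EReal) (B : κ → EReal) (Q : ℕ)
    (ε : ℝ) (s : BoxState κ E) : ℝ :=
  if ε < D.real (unsureSet c s) ∧ s.2.2.1 < Q then normPotential D c B s else 0

theorem measurable_activePotential (D : Measure E) [IsFiniteMeasure D]
    (hc : ∀ k, Measurable (c k)) (ε : ℝ) : Measurable (activePotential D c B Q ε) := by
  refine Measurable.ite (.inter ?_ ?_) (measurable_normPotential D hc) measurable_const
  · exact measurableSet_lt measurable_const
      (measurable_measureReal_section D (measurableSet_setOf_unsureSet hc))
  · exact (measurable_fst.comp (measurable_snd.comp measurable_snd)) measurableSet_Iio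

/-- In an active state the unsure mass exceeds `ε`, which bounds the drift factor. An inactive state
stays inactive because the unsure set only shrinks and the query count only grows. -/
theorem lintegral_activePotential_le (D : Measure E) [IsProbabilityMeasure D]
    (hc : ∀ k, Measurable (c k))
    (hmeas : ∀ n r, MeasurableSet {p : (ℕ → E) × E | resp n p.1 p.2 = r})
    (hκ : 0 < Fintype.card κ) (hs : IsConsistent c B s) (hresp : IsCorrectResp c B resp)
    {ε : ℝ} (hε1 : ε < 1) :
    ∫⁻ x, ENNReal.ofReal (activePotential D c B Q ε (boxStep Q c resp s x)) ∂D ≤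
      ENNReal.ofReal (1 - ε / (16 * Fintype.card κ)) *
        ENNReal.ofReal (activePotential D c B Q ε s) := by
  have hn1 : (1 : ℝ) ≤ Fintype.card κ := by exact_mod_cast hκ
  by_cases h : ε < D.real (unsureSet c s) ∧ s.2.2.1 < Q
  · have hle : ∀ x, activePotential D c B Q ε (boxStep Q c resp s x) ≤
        normPotential D c B (boxStep Q c resp s x) := fun x => by
      unfold activePotential
      split_ifs
      · exact le_rfl
      · exact normPotential_nonneg D _
    have hg0 : 0 ≤ normPotential D c B s := normPotential_nonneg D s
    calc _ ≤ ∫⁻ x, ENNReal.ofReal (normPotential D c B (boxStep Q c resp s x)) ∂D :=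
          lintegral_mono fun x => ENNReal.ofReal_le_ofReal (hle x)
      _ = ENNReal.ofReal (∫ x, normPotential D c B (boxStep Q c resp s x) ∂D) :=
          (ofReal_integral_eq_lintegral_ofReal (integrable_normPotential_boxStep D hc hmeas s)
            (.of_forall fun x => normPotential_nonneg D _)).symm
      _ ≤ ENNReal.ofReal ((1 - ε / (16 * Fintype.card κ)) * normPotential D c B s) := by
          apply ENNReal.ofReal_le_ofReal
          refine (integral_normPotential_boxStep_le D hc hmeas hκ hs hresp h.2).trans ?_
          rw [mul_comm]
          have := h.1
          gcongr
      _ = _ := by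
          rw [activePotential, if_pos h, ENNReal.ofReal_mul]
          rw [sub_nonneg, div_le_one (by linarith)]
          linarith
  · have : ∀ x, activePotential D c B Q ε (boxStep Q c resp s x) = 0 := fun x => by
      apply if_neg
      rintro ⟨h1, h2⟩
      exact h ⟨h1.trans_le (measureReal_mono (unsureSet_boxStep_subset x)),
        (boxStep_queries_ge x).trans_lt h2⟩
    simp [this]

theorem half_le_normPotential (D : Measure E) [IsFiniteMeasure D] (hs : IsConsistent c B s)
    {ε : ℝ} (hε0 : 0 < ε) (hε1 : ε < 1) (h : ε < D.real (unsureSet c s)) :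
    ε / 2 ≤ normPotential D c B s := by
  have hu := measureReal_unsureSet_le_boxPotential D hs
  unfold normPotential
  rw [div_le_div_iff₀ (by norm_num) (by linarith)]
  nlinarith

/-- After `N` samples and with `Q` allowed queries, the learner is likely to know almost all
labels. -/
theorem measure_unsure_le (D : Measure E) [IsProbabilityMeasure D]
    (hc : ∀ k, Measurable (c k))
    (hmeas : ∀ n r, MeasurableSet {p : (ℕ → E) × E | resp n p.1 p.2 = r})
    (hκ : 0 < Fintype.card κ) (hresp : IsCorrectResp c B resp)
    {s₀ : BoxState κ E} (h0 : IsConsistent c B s₀) (hq0 : s₀.2.2.1 = 0)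
    {ε : ℝ} (hε0 : 0 < ε) (hε1 : ε < 1) (N : ℕ) :
    Measure.infinitePi (fun _ : ℕ => D)
      {ω | ε < D.real (unsureSet c (drivenChain (boxStep Q c resp) s₀ ω N))} ≤
      ENNReal.ofReal ((1 - 1 / (16 * Fintype.card κ)) ^ Q / (ε / 2) +
        (1 - ε / (16 * Fintype.card κ)) ^ N / (ε / 2)) := by
  set P := Measure.infinitePi (fun _ : ℕ => D)
  have hn1 : (1 : ℝ) ≤ Fintype.card κ := by exact_mod_cast hκ
  set r : ℝ := 1 - 1 / (16 * Fintype.card κ) with hr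
  set r' : ℝ := 1 - ε / (16 * Fintype.card κ) with hr'
  have hr0 : 0 < r := by
    rw [hr, sub_pos, div_lt_one (by linarith)]; linarith
  have hr1 : r ≤ 1 := by
    have : (0 : ℝ) ≤ 1 / (16 * Fintype.card κ) := by positivity
    linarith
  have hr0' : 0 ≤ r' := by
    rw [hr', sub_nonneg, div_le_one (by linarith)]; linarith
  have hstep := measurable_boxStep (Q := Q) hc hmeas
  have hcons : ∀ s x, IsConsistent c B s → IsConsistent c B (boxStep Q c resp s x) :=
    fun s x hs => hs.boxStep hresp x
  set f₁ : BoxState κ E → ℝ≥0∞ := fun s =>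
    ENNReal.ofReal (normPotential D c B s * (r ^ s.2.2.1)⁻¹) with hf₁
  set f₂ : BoxState κ E → ℝ≥0∞ := fun s =>
    ENNReal.ofReal (activePotential D c B Q ε s) with hf₂
  have hm₁ : Measurable f₁ := by
    refine ENNReal.measurable_ofReal.comp ((measurable_normPotential D hc).mul ?_)
    exact (Measurable.of_discrete (f := fun q : ℕ => (r ^ q)⁻¹)).comp
      (measurable_fst.comp (measurable_snd.comp measurable_snd))
  have hm₂ : Measurable f₂ := ENNReal.measurable_ofReal.comp (measurable_activePotential D hc ε)
  set X : (ℕ → E) → BoxState κ E := fun ω => drivenChain (boxStep Q c resp) s₀ ω N with hX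
  have hXm : Measurable X := measurable_drivenChain hstep s₀ N
  have hb₁ : ∫⁻ ω, f₁ (X ω) ∂P ≤ 1 := by
    refine (lintegral_drivenChain_le D hstep h0 hcons hm₁ 1 (fun s hs => ?_) N).trans ?_
    · rw [one_mul]
      exact lintegral_normPotential_mul_le D hc hmeas hκ hs hresp hr
    · rw [one_pow, one_mul, hf₁]
      simpa [hq0] using normPotential_le_one D s₀
  have hb₂ : ∫⁻ ω, f₂ (X ω) ∂P ≤ ENNReal.ofReal (r' ^ N) := by
    refine (lintegral_drivenChain_le D hstep h0 hcons hm₂ (ENNReal.ofReal r') (fun s hs =>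
      lintegral_activePotential_le D hc hmeas hκ hs hresp hε1) N).trans ?_
    rw [ENNReal.ofReal_pow hr0']
    refine mul_le_of_le_one_right' ?_
    rw [hf₂, ENNReal.ofReal_le_one]
    unfold activePotential
    split_ifs
    · exact normPotential_le_one D s₀
    · exact zero_le_one
  have hsub : {ω | ε < D.real (unsureSet c (X ω))} ⊆
      {ω | ENNReal.ofReal (ε / 2 * (r ^ Q)⁻¹) ≤ f₁ (X ω)} ∪
        {ω | ENNReal.ofReal (ε / 2) ≤ f₂ (X ω)} := by
    intro ω hω
    have hcX : IsConsistent c B (X ω) := drivenChain_induction h0 hcons ω N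
    have hhalf := half_le_normPotential D hcX hε0 hε1 hω
    -- On failure the normalized potential is at least `ε / 2`. With budget left it is still active;
    -- with the budget spent its rescaling is at least `ε / 2 * (r ^ Q)⁻¹`.
    by_cases hq : (X ω).2.2.1 < Q
    · right
      apply ENNReal.ofReal_le_ofReal
      rw [activePotential, if_pos ⟨hω, hq⟩]
      exact hhalf
    · left
      apply ENNReal.ofReal_le_ofReal
      have : (r ^ Q)⁻¹ ≤ (r ^ (X ω).2.2.1)⁻¹ :=
        inv_anti₀ (by positivity) (pow_le_pow_of_le_one hr0.le hr1 (not_lt.1 hq))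
      have := normPotential_nonneg (c := c) (B := B) D (X ω)
      gcongr
  have h1 : P {ω | ENNReal.ofReal (ε / 2 * (r ^ Q)⁻¹) ≤ f₁ (X ω)} ≤
      ENNReal.ofReal (r ^ Q / (ε / 2)) := by
    refine (meas_ge_le_lintegral_div (hm₁.comp hXm).aemeasurable
      (ENNReal.ofReal_pos.2 (by positivity)).ne' ENNReal.ofReal_ne_top).trans ?_
    refine (ENNReal.div_le_div_right hb₁ _).trans ?_
    rw [← ENNReal.ofReal_one, ← ENNReal.ofReal_div_of_pos (by positivity)]
    apply ENNReal.ofReal_le_ofReal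
    apply le_of_eq
    field_simp
  have h2 : P {ω | ENNReal.ofReal (ε / 2) ≤ f₂ (X ω)} ≤ ENNReal.ofReal (r' ^ N / (ε / 2)) := by
    refine (meas_ge_le_lintegral_div (hm₂.comp hXm).aemeasurable
      (ENNReal.ofReal_pos.2 (by positivity)).ne' ENNReal.ofReal_ne_top).trans ?_
    refine (ENNReal.div_le_div_right hb₂ _).trans ?_
    rw [← ENNReal.ofReal_div_of_pos (by positivity)]
  calc P {ω | ε < D.real (unsureSet c (X ω))} ≤ _ := measure_mono hsub
    _ ≤ _ := measure_union_le _ _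
    _ ≤ _ := add_le_add h1 h2
    _ = _ := (ENNReal.ofReal_add (by positivity) (by positivity)).symm

end Tail

/-! ### Calculus of machine runs -/

namespace Learner

variable {d : ℕ} {L : Learner d} {adv : Adversary d} {ω : ℕ → Fin d → ℝ}

/-- One step of a run, where a halted learner stays in its configuration. -/
noncomputable def advance (L : Learner d) (adv : Adversary d) (ω : ℕ → Fin d → ℝ) (c : L.Config) :
    L.Config :=
  (L.step adv ω c).getD c

theorem run_eq_iterate (t : ℕ) : L.run adv ω t = (L.advance adv ω)^[t] L.init := rfl

theorem run_eq_of_haltedAt {t : ℕ} (h : L.HaltedAt adv ω t) {t' : ℕ} (ht : t ≤ t') :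
    L.run adv ω t' = L.run adv ω t := by
  induction t', ht using Nat.le_induction with
  | base => rfl
  | succ t' _ ih =>
    rw [run_eq_iterate, Function.iterate_succ_apply', ← run_eq_iterate, ih, advance, h]
    rfl

theorem result_eq_of_haltedAt {t : ℕ} (h : L.HaltedAt adv ω t) :
    L.result adv ω = L.output (L.run adv ω t).queryTape (L.run adv ω t).workTape := by
  classical
  have hh : ∃ t, L.HaltedAt adv ω t := ⟨t, h⟩
  rw [result, dif_pos hh, run_eq_of_haltedAt (Nat.find_spec hh) (Nat.find_min' hh h)]

/-- The configuration `c'` is reached from `c` after at most `T` steps. -/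
def ReachesIn (L : Learner d) (adv : Adversary d) (ω : ℕ → Fin d → ℝ) (T : ℕ) (c c' : L.Config) :
    Prop :=
  ∃ t ≤ T, (L.advance adv ω)^[t] c = c'

theorem ReachesIn.refl (c : L.Config) (T : ℕ) : L.ReachesIn adv ω T c c := ⟨0, T.zero_le, rfl⟩

theorem ReachesIn.trans {T T' : ℕ} {c c' c'' : L.Config} (h : L.ReachesIn adv ω T c c')
    (h' : L.ReachesIn adv ω T' c' c'') : L.ReachesIn adv ω (T + T') c c'' := by
  obtain ⟨t, ht, rfl⟩ := h
  obtain ⟨t', ht', rfl⟩ := h'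
  exact ⟨t' + t, by omega, Function.iterate_add_apply _ _ _ _⟩

theorem ReachesIn.mono {T T' : ℕ} {c c' : L.Config} (h : L.ReachesIn adv ω T c c')
    (hT : T ≤ T') : L.ReachesIn adv ω T' c c' :=
  h.imp fun _ ht => ⟨ht.1.trans hT, ht.2⟩

theorem reachesIn_one {c c' : L.Config} (h : L.step adv ω c = some c') :
    L.ReachesIn adv ω 1 c c' :=
  ⟨1, le_rfl, by simp [advance, h]⟩

section Step

variable {c : L.Config}

theorem step_sample {j : Fin L.cells} {next : L.Control}
    (h : L.program c.control c.samples c.queries = .sample j next) :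
    L.step adv ω c = some { c with
      control := next
      queryTape := Function.update c.queryTape j (some (ω c.samples))
      samples := c.samples + 1 } := by
  unfold step; rw [h]

theorem step_copy {j k : Fin L.cells} {next : L.Control}
    (h : L.program c.control c.samples c.queries = .copy j k next) :
    L.step adv ω c = some { c with
      control := next
      queryTape := Function.update c.queryTape k (c.queryTape j) } := by
  unfold step; rw [h]

/-- Copying a cell onto itself serves as a pure jump between control states. -/
theorem step_copy_self {j : Fin L.cells} {next : L.Control}
    (h : L.program c.control c.samples c.queries = .copy j j next) :
    L.step adv ω c = some { c with control := next } := by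
  rw [step_copy h, Function.update_eq_self]

theorem step_query {j : Fin L.cells} {next : OddResponse d → L.Control}
    (h : L.program c.control c.samples c.queries = .query j next) {x : Fin d → ℝ}
    (hx : c.queryTape j = some x) :
    L.step adv ω c = some { c with
      control := next (adv c.queries c.asked x)
      queries := c.queries + 1
      asked := Function.update c.asked c.queries x } := by
  unfold step; rw [h]; simp [hx]

open Classical in
theorem step_compare {i : Fin d} {j k : Fin L.cells} {next : Bool → L.Control}
    (h : L.program c.control c.samples c.queries = .compare i j k next) :
    L.step adv ω c = some { c with
      control := next (decide (∃ x y, c.queryTape j = some x ∧ c.queryTape k = some y ∧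
        x i ≤ y i)) } := by
  unfold step; rw [h]

theorem step_halt (h : L.program c.control c.samples c.queries = .halt) :
    L.step adv ω c = none := by
  unfold step; rw [h]

end Step

end Learner

/-! ### Rectangles as boxes in signed coordinates -/

section SignedCoordinates

variable {d : ℕ}

/-- An enumeration of the directions in `ℝ^d`. -/
noncomputable def dirEquiv (d : ℕ) : Fin d × Bool ≃ Fin (d * 2) :=
  Fintype.equivFinOfCardEq (by simp)

/-- The coordinate in the `j`-th direction. -/
noncomputable def signedCoord (j : Fin (d * 2)) (x : Fin d → ℝ) : EReal :=
  if ((dirEquiv d).symm j).2 then (x ((dirEquiv d).symm j).1 : EReal)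
  else ((-x ((dirEquiv d).symm j).1 : ℝ) : EReal)

theorem signedCoord_lt_top (j : Fin (d * 2)) (x : Fin d → ℝ) : signedCoord j x < ⊤ := by
  unfold signedCoord; split_ifs <;> exact EReal.coe_lt_top _

theorem bot_lt_signedCoord (j : Fin (d * 2)) (x : Fin d → ℝ) : ⊥ < signedCoord j x := by
  unfold signedCoord; split_ifs <;> exact EReal.bot_lt_coe _

theorem measurable_signedCoord (j : Fin (d * 2)) : Measurable (signedCoord j) := by
  unfold signedCoord
  split_ifs
  · exact (measurable_pi_apply _).coe_real_ereal
  · exact (measurable_pi_apply _).neg.coe_real_ereal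

/-- The side of the rectangle in the `j`-th direction. -/
noncomputable def Rectangle.side (h : Rectangle d) (j : Fin (d * 2)) : EReal :=
  if ((dirEquiv d).symm j).2 then h.upper ((dirEquiv d).symm j).1
  else -h.lower ((dirEquiv d).symm j).1

/-- Negating a coordinate turns a lower bound into an upper bound, so a rectangle becomes `2d` upper
bounds. -/
theorem Rectangle.mem_carrier_iff (h : Rectangle d) (x : Fin d → ℝ) :
    x ∈ h.carrier ↔ ∀ j, signedCoord j x ≤ h.side j := by
  rw [(dirEquiv d).surjective.forall]
  simp only [Rectangle.carrier, signedCoord, Rectangle.side, Equiv.symm_apply_apply, Prod.forall,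
    Bool.forall_bool, Bool.false_eq_true, if_false, if_true, EReal.coe_neg, EReal.neg_le_neg_iff]
  rfl

/-- The responses of the adversary as directions. -/
noncomputable def Adversary.direction (adv : Adversary d) (n : ℕ) (past : ℕ → Fin d → ℝ)
    (x : Fin d → ℝ) : Option (Fin (d * 2)) :=
  (adv n past x).map (dirEquiv d)

theorem Adversary.IsValid.isCorrectResp {adv : Adversary d} {h : Rectangle d}
    (hadv : adv.IsValid h) : IsCorrectResp signedCoord h.side adv.direction := by
  intro n past x
  have hv := hadv n past x
  refine ⟨fun hr => ?_, fun j hr => ?_⟩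
  · have hr' : adv n past x = none := by simpa [direction] using hr
    rw [hr'] at hv
    rcases hv with hv | ⟨-, i, hv | hv⟩
    · rw [← Rectangle.mem_carrier_iff]
      simpa [Rectangle.label] using hv.1
    · simp at hv
    · simp at hv
  · obtain ⟨a, ha, rfl⟩ := Option.map_eq_some_iff.1 hr
    rw [ha] at hv
    rcases hv with hv | ⟨-, i, hv | hv⟩
    · simp at hv
    · obtain ⟨rfl, hv⟩ : a = (i, true) ∧ _ := ⟨by simpa using hv.1, hv.2⟩
      simpa [signedCoord, Rectangle.side] using hv
    · obtain ⟨rfl, hv⟩ : a = (i, false) ∧ _ := ⟨by simpa using hv.1, hv.2⟩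
      simpa [signedCoord, Rectangle.side, EReal.neg_lt_neg_iff] using hv

theorem Adversary.IsMeasurable.direction {adv : Adversary d} (hadv : adv.IsMeasurable) (n : ℕ)
    (r : Option (Fin (d * 2))) :
    MeasurableSet {p : (ℕ → Fin d → ℝ) × (Fin d → ℝ) | adv.direction n p.1 p.2 = r} := by
  have : {p : (ℕ → Fin d → ℝ) × (Fin d → ℝ) | adv.direction n p.1 p.2 = r} =
      {p | adv n p.1 p.2 = r.map (dirEquiv d).symm} := by
    ext p
    simp only [Adversary.direction, mem_ofPred_eq]
    constructor
    · rintro rfl; simp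
    · intro hp; simp [hp]
  rw [this]
  exact hadv n _

end SignedCoordinates

/-! ### The concrete machine and its loops -/

section Machine

variable {d : ℕ}

/-- The cells of the query tape: the current point (`none`), an extreme positive point
(`some (true, j)`) and an extreme negative point (`some (false, j)`) for each direction `j`. -/
abbrev BoxCell (d : ℕ) : Type := Option (Bool × Fin (d * 2))

/-- The address of a cell. -/
noncomputable def cellIdx (d : ℕ) : BoxCell d ≃ Fin (Fintype.card (BoxCell d)) :=
  Fintype.equivFin _

/-- The control states: draw a point, query it, run through the negative respectively positive
extreme points, and update the positive respectively negative extreme points. -/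
inductive BoxControl (d : ℕ) : Type
  | draw
  | ask
  | checkNeg (j : Fin (d * 2 + 1))
  | checkPos (j : Fin (d * 2 + 1))
  | raise (j : Fin (d * 2 + 1))
  | storePos (j : Fin (d * 2))
  | storeNeg (j : Fin (d * 2))

/-- The control states as a sum. -/
def BoxControl.toSum : BoxControl d →
    Bool ⊕ (Fin 3 × Fin (d * 2 + 1)) ⊕ (Bool × Fin (d * 2))
  | .draw => .inl true
  | .ask => .inl false
  | .checkNeg j => .inr (.inl (0, j))
  | .checkPos j => .inr (.inl (1, j))
  | .raise j => .inr (.inl (2, j))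
  | .storePos j => .inr (.inr (true, j))
  | .storeNeg j => .inr (.inr (false, j))

theorem BoxControl.toSum_injective : Function.Injective (BoxControl.toSum (d := d)) := by
  intro a b h
  cases a <;> cases b <;> simp_all [BoxControl.toSum]

noncomputable instance : Fintype (BoxControl d) := Fintype.ofInjective _ BoxControl.toSum_injective

theorem BoxControl.card_le (d : ℕ) : Fintype.card (BoxControl d) ≤ 10 * d + 5 := by
  refine (Fintype.card_le_of_injective _ BoxControl.toSum_injective).trans (le_of_eq ?_)
  simp only [Fintype.card_sum, Fintype.card_prod, Fintype.card_bool, Fintype.card_fin]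
  ring

/-- Test whether the signed coordinate of cell `a` is at most that of cell `b`. -/
noncomputable def compareSigned {Q : Type} (j : Fin (d * 2)) (a b : BoxCell d) (next : Bool → Q) :
    Instruction d (Fintype.card (BoxCell d)) 0 Q :=
  if ((dirEquiv d).symm j).2 then
    .compare ((dirEquiv d).symm j).1 (cellIdx d a) (cellIdx d b) next
  -- Negation reverses the order, so the two cells are swapped.
  else .compare ((dirEquiv d).symm j).1 (cellIdx d b) (cellIdx d a) next

/-- The program of the learner with sample budget `N` and query budget `Q`. -/
noncomputable def boxProgram (d N Q : ℕ) (q : BoxControl d) (samples queries : ℕ) :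
    Instruction d (Fintype.card (BoxCell d)) 0 (BoxControl d) :=
  match q with
  | .draw => if N ≤ samples ∨ Q ≤ queries then .halt else .sample (cellIdx d none) (.checkNeg 0)
  | .checkNeg j =>
    if hj : j.val < d * 2 then
      compareSigned ⟨j, hj⟩ (some (false, ⟨j, hj⟩)) none fun b =>
        if b then .draw else .checkNeg ⟨j + 1, by omega⟩
    else .copy (cellIdx d none) (cellIdx d none) (.checkPos 0)
  | .checkPos j =>
    if hj : j.val < d * 2 then
      compareSigned ⟨j, hj⟩ none (some (true, ⟨j, hj⟩)) fun b =>
        if b then .checkPos ⟨j + 1, by omega⟩ else .ask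
    else .copy (cellIdx d none) (cellIdx d none) .draw
  | .ask => .query (cellIdx d none) fun r => r.elim (.raise 0) fun a => .storeNeg (dirEquiv d a)
  | .raise j =>
    if hj : j.val < d * 2 then
      compareSigned ⟨j, hj⟩ none (some (true, ⟨j, hj⟩)) fun b =>
        if b then .raise ⟨j + 1, by omega⟩ else .storePos ⟨j, hj⟩
    else .copy (cellIdx d none) (cellIdx d none) .draw
  | .storePos j => .copy (cellIdx d none) (cellIdx d (some (true, j))) (.raise j.succ)
  | .storeNeg j => .copy (cellIdx d none) (cellIdx d (some (false, j))) .draw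

/-- The largest known positive value in direction `j`. -/
noncomputable def posBound (tape : Fin (Fintype.card (BoxCell d)) → Option (Fin d → ℝ))
    (j : Fin (d * 2)) : EReal :=
  (tape (cellIdx d (some (true, j)))).elim ⊥ (signedCoord j)

/-- The smallest known negative value in direction `j`. -/
noncomputable def negBound (tape : Fin (Fintype.card (BoxCell d)) → Option (Fin d → ℝ))
    (j : Fin (d * 2)) : EReal :=
  (tape (cellIdx d (some (false, j)))).elim ⊤ (signedCoord j)

open Classical in
/-- The learner with sample budget `N` and query budget `Q`. -/
noncomputable abbrev boxLearner (d N Q : ℕ) : Learner d where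
  cells := Fintype.card (BoxCell d)
  bits := 0
  Control := BoxControl d
  start := .draw
  program := boxProgram d N Q
  output tape _ x :=
    if ∃ j, negBound tape j ≤ signedCoord j x then some false
    else if ∀ j, signedCoord j x ≤ posBound tape j then some true
    else none

variable {N Q : ℕ} {adv : Adversary d} {ω : ℕ → Fin d → ℝ}

theorem boxLearner_memory_le (d N Q : ℕ) : (boxLearner d N Q).memory ≤ 14 * d + 6 := by
  have h1 : (boxLearner d N Q).cells = 4 * d + 1 := by
    simp; ring
  have h2 : (boxLearner d N Q).bits = 0 := rfl
  have h3 : Fintype.card (boxLearner d N Q).Control ≤ 10 * d + 5 := BoxControl.card_le d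
  rw [Learner.memory]
  omega

/-- The knowledge stored in a configuration. -/
noncomputable def boxKnowledge (c : (boxLearner d N Q).Config) :
    BoxState (Fin (d * 2)) (Fin d → ℝ) :=
  (posBound c.queryTape, negBound c.queryTape, c.queries, c.asked)

open Classical in
theorem step_compareSigned {c : (boxLearner d N Q).Config} {j : Fin (d * 2)} {a b : BoxCell d}
    {next : Bool → BoxControl d}
    (h : boxProgram d N Q c.control c.samples c.queries = compareSigned j a b next) :
    (boxLearner d N Q).step adv ω c = some { c with
      control := next (decide (∃ x y, c.queryTape (cellIdx d a) = some x ∧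
        c.queryTape (cellIdx d b) = some y ∧ signedCoord j x ≤ signedCoord j y)) } := by
  unfold compareSigned at h
  split_ifs at h with hb
  · rw [Learner.step_compare (L := boxLearner d N Q) h]
    simp [signedCoord, hb]
  · rw [Learner.step_compare (L := boxLearner d N Q) h]
    have : (∃ x y, c.queryTape (cellIdx d b) = some x ∧ c.queryTape (cellIdx d a) = some y ∧
        x ((dirEquiv d).symm j).1 ≤ y ((dirEquiv d).symm j).1) ↔
      (∃ x y, c.queryTape (cellIdx d a) = some x ∧
        c.queryTape (cellIdx d b) = some y ∧ signedCoord j x ≤ signedCoord j y) := by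
      simp only [signedCoord, hb, Bool.false_eq_true, if_false, EReal.coe_le_coe_iff,
        neg_le_neg_iff]
      tauto
    simp only [← this]

/-- Comparison with an empty cell fails, in agreement with the default `⊤`, since signed coordinates
are finite. -/
theorem exists_neg_le_iff {c : (boxLearner d N Q).Config} {x : Fin d → ℝ}
    (hx : c.queryTape (cellIdx d none) = some x) (j : Fin (d * 2)) :
    (∃ y z, c.queryTape (cellIdx d (some (false, j))) = some y ∧
      c.queryTape (cellIdx d none) = some z ∧ signedCoord j y ≤ signedCoord j z) ↔
      negBound c.queryTape j ≤ signedCoord j x := by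
  unfold negBound
  rcases h : c.queryTape (cellIdx d (some (false, j))) with _ | y
  · simp [(signedCoord_lt_top j x).ne]
  · simp [hx]

theorem exists_le_pos_iff {c : (boxLearner d N Q).Config} {x : Fin d → ℝ}
    (hx : c.queryTape (cellIdx d none) = some x) (j : Fin (d * 2)) :
    (∃ y z, c.queryTape (cellIdx d none) = some y ∧
      c.queryTape (cellIdx d (some (true, j))) = some z ∧ signedCoord j y ≤ signedCoord j z) ↔
      signedCoord j x ≤ posBound c.queryTape j := by
  unfold posBound
  rcases h : c.queryTape (cellIdx d (some (true, j))) with _ | y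
  · simp [(bot_lt_signedCoord j x).ne']
  · simp [hx]

open Classical in
-- Induction on the number `m` of directions still to be tested; the extra step is the jump out of
-- the loop at index `2d`.
theorem reachesIn_checkNeg {x : Fin d → ℝ} (m : ℕ) (c : (boxLearner d N Q).Config)
    (j : Fin (d * 2 + 1)) (hj : j.val + m = d * 2) (hc : c.control = BoxControl.checkNeg j)
    (hx : c.queryTape (cellIdx d none) = some x) :
    (boxLearner d N Q).ReachesIn adv ω (m + 1) c { c with
      control := if ∃ k : Fin (d * 2), j.val ≤ k ∧ negBound c.queryTape k ≤ signedCoord k x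
        then BoxControl.draw else BoxControl.checkPos 0 } := by
  induction m generalizing c j with
  | zero =>
    have hp : boxProgram d N Q c.control c.samples c.queries =
        .copy (cellIdx d none) (cellIdx d none) (.checkPos 0) := by
      rw [hc]; exact dif_neg (by omega)
    have hno : ¬ ∃ k : Fin (d * 2), j.val ≤ k ∧ negBound c.queryTape k ≤ signedCoord k x := by
      rintro ⟨k, hk, -⟩; omega
    rw [if_neg hno]
    exact Learner.reachesIn_one (Learner.step_copy_self (L := boxLearner d N Q) hp)
  | succ m ih =>
    have hlt : j.val < d * 2 := by omega
    have hp : boxProgram d N Q c.control c.samples c.queries =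
        compareSigned ⟨j, hlt⟩ (some (false, ⟨j, hlt⟩)) none fun b =>
          if b then .draw else .checkNeg ⟨j + 1, by omega⟩ := by
      rw [hc]; exact dif_pos hlt
    have hs := step_compareSigned (adv := adv) (ω := ω) hp
    rw [exists_neg_le_iff hx] at hs
    by_cases hk : negBound c.queryTape ⟨j, hlt⟩ ≤ signedCoord ⟨j, hlt⟩ x
    · rw [if_pos ⟨⟨j, hlt⟩, le_rfl, hk⟩]
      simp only [hk, decide_true, if_true] at hs
      exact (Learner.reachesIn_one hs).mono (by omega)
    · simp only [hk, decide_false, Bool.false_eq_true, if_false] at hs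
      have h2 := ih { c with control := BoxControl.checkNeg ⟨j + 1, by omega⟩ } ⟨j + 1, by omega⟩
        (by simp only; omega) rfl hx
      have h3 := (Learner.reachesIn_one hs).trans h2
      rw [add_comm 1] at h3
      have hiff : (∃ k : Fin (d * 2), j.val + 1 ≤ k ∧
          negBound c.queryTape k ≤ signedCoord k x) ↔
          ∃ k : Fin (d * 2), j.val ≤ k ∧ negBound c.queryTape k ≤ signedCoord k x := by
        refine exists_congr fun k => and_congr_left fun hle => ⟨fun h => by omega, fun h => ?_⟩
        rcases h.lt_or_eq with h | h
        · exact h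
        · exact absurd (show negBound c.queryTape ⟨j, hlt⟩ ≤ _ by
            rwa [show (⟨j, hlt⟩ : Fin (d * 2)) = k from Fin.ext h]) hk
      simp only [hiff] at h3
      exact h3

open Classical in
theorem reachesIn_checkPos {x : Fin d → ℝ} (m : ℕ) (c : (boxLearner d N Q).Config)
    (j : Fin (d * 2 + 1)) (hj : j.val + m = d * 2) (hc : c.control = BoxControl.checkPos j)
    (hx : c.queryTape (cellIdx d none) = some x) :
    (boxLearner d N Q).ReachesIn adv ω (m + 1) c { c with
      control := if ∃ k : Fin (d * 2), j.val ≤ k ∧ posBound c.queryTape k < signedCoord k x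
        then BoxControl.ask else BoxControl.draw } := by
  induction m generalizing c j with
  | zero =>
    have hp : boxProgram d N Q c.control c.samples c.queries =
        .copy (cellIdx d none) (cellIdx d none) .draw := by
      rw [hc]; exact dif_neg (by omega)
    have hno : ¬ ∃ k : Fin (d * 2), j.val ≤ k ∧ posBound c.queryTape k < signedCoord k x := by
      rintro ⟨k, hk, -⟩; omega
    rw [if_neg hno]
    exact Learner.reachesIn_one (Learner.step_copy_self (L := boxLearner d N Q) hp)
  | succ m ih =>
    have hlt : j.val < d * 2 := by omega
    have hp : boxProgram d N Q c.control c.samples c.queries =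
        compareSigned ⟨j, hlt⟩ none (some (true, ⟨j, hlt⟩)) fun b =>
          if b then .checkPos ⟨j + 1, by omega⟩ else .ask := by
      rw [hc]; exact dif_pos hlt
    have hs := step_compareSigned (adv := adv) (ω := ω) hp
    rw [exists_le_pos_iff hx] at hs
    by_cases hk : signedCoord ⟨j, hlt⟩ x ≤ posBound c.queryTape ⟨j, hlt⟩
    · simp only [hk, decide_true, if_true] at hs
      have h2 := ih { c with control := BoxControl.checkPos ⟨j + 1, by omega⟩ } ⟨j + 1, by omega⟩
        (by simp only; omega) rfl hx
      have h3 := (Learner.reachesIn_one hs).trans h2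
      rw [add_comm 1] at h3
      have hiff : (∃ k : Fin (d * 2), j.val + 1 ≤ k ∧
          posBound c.queryTape k < signedCoord k x) ↔
          ∃ k : Fin (d * 2), j.val ≤ k ∧ posBound c.queryTape k < signedCoord k x := by
        refine exists_congr fun k => and_congr_left fun hle => ⟨fun h => by omega, fun h => ?_⟩
        rcases h.lt_or_eq with h | h
        · exact h
        · exact absurd (show posBound c.queryTape ⟨j, hlt⟩ < _ by
            rwa [show (⟨j, hlt⟩ : Fin (d * 2)) = k from Fin.ext h]) (not_lt.2 hk)
      simp only [hiff] at h3
      exact h3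
    · rw [if_pos ⟨⟨j, hlt⟩, le_rfl, not_le.1 hk⟩]
      simp only [hk, decide_false, Bool.false_eq_true, if_false] at hs
      exact (Learner.reachesIn_one hs).mono (by omega)

/-- Each direction costs at most a comparison and a copy. Only the bounds read off the final tape
matter, so the tape itself is left existential. -/
theorem reachesIn_raise {x : Fin d → ℝ} (m : ℕ) (c : (boxLearner d N Q).Config)
    (j : Fin (d * 2 + 1)) (hj : j.val + m = d * 2) (hc : c.control = BoxControl.raise j)
    (hx : c.queryTape (cellIdx d none) = some x) :
    ∃ tape, (boxLearner d N Q).ReachesIn adv ω (2 * m + 1) c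
        { c with control := BoxControl.draw, queryTape := tape } ∧
      (∀ k, negBound tape k = negBound c.queryTape k) ∧
      ∀ k : Fin (d * 2), posBound tape k = if j.val ≤ k
        then max (posBound c.queryTape k) (signedCoord k x) else posBound c.queryTape k := by
  induction m generalizing c j with
  | zero =>
    have hp : boxProgram d N Q c.control c.samples c.queries =
        .copy (cellIdx d none) (cellIdx d none) .draw := by
      rw [hc]; exact dif_neg (by omega)
    refine ⟨c.queryTape,
      Learner.reachesIn_one (Learner.step_copy_self (L := boxLearner d N Q) hp),
      fun _ => rfl, fun k => ?_⟩
    rw [if_neg (by omega)]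
  | succ m ih =>
    classical
    have hlt : j.val < d * 2 := by omega
    have hp : boxProgram d N Q c.control c.samples c.queries =
        compareSigned ⟨j, hlt⟩ none (some (true, ⟨j, hlt⟩)) fun b =>
          if b then .raise ⟨j + 1, by omega⟩ else .storePos ⟨j, hlt⟩ := by
      rw [hc]; exact dif_pos hlt
    have hs := step_compareSigned (adv := adv) (ω := ω) hp
    rw [exists_le_pos_iff hx] at hs
    by_cases hk : signedCoord ⟨j, hlt⟩ x ≤ posBound c.queryTape ⟨j, hlt⟩
    · simp only [hk, decide_true, if_true] at hs
      obtain ⟨tape, h1, h2, h3⟩ := ih { c with control := BoxControl.raise ⟨j + 1, by omega⟩ }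
        ⟨j + 1, by omega⟩ (by simp only; omega) rfl hx
      refine ⟨tape, ((Learner.reachesIn_one hs).trans h1).mono (by omega), h2, fun k => ?_⟩
      rw [h3 k]
      by_cases hjk : j.val = k
      · obtain rfl : (⟨j, hlt⟩ : Fin (d * 2)) = k := Fin.ext hjk
        simp [hk]
      · have : j.val + 1 ≤ k ↔ j.val ≤ k := by omega
        simp only [this]
    · simp only [hk, decide_false, Bool.false_eq_true, if_false] at hs
      set c₁ : (boxLearner d N Q).Config :=
        { c with control := BoxControl.storePos ⟨j, hlt⟩ } with hc₁
      have hp₁ : boxProgram d N Q c₁.control c₁.samples c₁.queries =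
          .copy (cellIdx d none) (cellIdx d (some (true, ⟨j, hlt⟩)))
            (.raise ⟨j + 1, by omega⟩) := rfl
      have hs₁ := Learner.step_copy (L := boxLearner d N Q) (c := c₁) (adv := adv) (ω := ω) hp₁
      set T := Function.update c.queryTape (cellIdx d (some (true, ⟨j, hlt⟩)))
        (c.queryTape (cellIdx d none)) with hT
      have hTx : T (cellIdx d none) = some x := by
        rw [hT, Function.update_of_ne (by simp)]; exact hx
      have hTneg : ∀ k, negBound T k = negBound c.queryTape k := fun k => by
        rw [negBound, hT, Function.update_of_ne (by simp)]; rfl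
      have hTpos : ∀ k, posBound T k = if k = ⟨j, hlt⟩ then signedCoord k x
          else posBound c.queryTape k := fun k => by
        by_cases hk' : k = ⟨j, hlt⟩
        · subst hk'
          rw [posBound, hT, Function.update_self, hx]
          simp
        · rw [posBound, hT, Function.update_of_ne (by simpa using hk'), if_neg hk']; rfl
      obtain ⟨tape, h1, h2, h3⟩ := ih
        { c with control := BoxControl.raise ⟨j + 1, by omega⟩, queryTape := T }
        ⟨j + 1, by omega⟩ (by simp only; omega) rfl hTx
      refine ⟨tape, (((Learner.reachesIn_one hs).trans (Learner.reachesIn_one hs₁)).trans h1).mono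
        (by omega), fun k => (h2 k).trans (hTneg k), fun k => ?_⟩
      rw [h3 k]
      simp only [hTpos]
      by_cases hjk : j.val = k
      · obtain rfl : (⟨j, hlt⟩ : Fin (d * 2)) = k := Fin.ext hjk
        simp [(not_le.1 hk).le]
      · have h4 : j.val + 1 ≤ k ↔ j.val ≤ k := by omega
        have h5 : ¬ k = ⟨j, hlt⟩ := fun h => hjk (by rw [h])
        simp only [h4, if_neg h5]

end Machine

/-! ### The machine simulates the abstract learner -/

section Run

variable {d N Q : ℕ} {adv : Adversary d} {ω : ℕ → Fin d → ℝ}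

theorem boxProgram_sample {samples queries : ℕ} (hN : samples < N) (hQ : queries < Q) :
    boxProgram d N Q .draw samples queries = .sample (cellIdx d none) (.checkNeg 0) :=
  if_neg (by omega)

theorem posBound_update_none (tape : Fin (Fintype.card (BoxCell d)) → Option (Fin d → ℝ))
    (v : Option (Fin d → ℝ)) :
    posBound (Function.update tape (cellIdx d none) v) = posBound tape := by
  ext j
  rw [posBound, Function.update_of_ne (by simp)]; rfl

theorem negBound_update_none (tape : Fin (Fintype.card (BoxCell d)) → Option (Fin d → ℝ))
    (v : Option (Fin d → ℝ)) :
    negBound (Function.update tape (cellIdx d none) v) = negBound tape := by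
  ext j
  rw [negBound, Function.update_of_ne (by simp)]; rfl

theorem posBound_update_neg (tape : Fin (Fintype.card (BoxCell d)) → Option (Fin d → ℝ))
    (k : Fin (d * 2)) (v : Option (Fin d → ℝ)) :
    posBound (Function.update tape (cellIdx d (some (false, k))) v) = posBound tape := by
  ext j
  rw [posBound, Function.update_of_ne (by simp)]; rfl

theorem negBound_update_neg (tape : Fin (Fintype.card (BoxCell d)) → Option (Fin d → ℝ))
    (k : Fin (d * 2)) (x : Fin d → ℝ) :
    negBound (Function.update tape (cellIdx d (some (false, k))) (some x)) =
      Function.update (negBound tape) k (signedCoord k x) := by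
  ext j
  by_cases hj : j = k
  · subst hj
    rw [negBound, Function.update_self, Function.update_self]; rfl
  · rw [negBound, Function.update_of_ne (by simpa using hj), Function.update_of_ne hj]; rfl

/-- Processing one point of the stream takes a linear number of steps. -/
theorem exists_reachesIn_draw (c : (boxLearner d N Q).Config) (hc : c.control = BoxControl.draw)
    (hN : c.samples < N) (hQ : c.queries < Q) :
    ∃ c', (boxLearner d N Q).ReachesIn adv ω (8 * d + 5) c c' ∧ c'.control = BoxControl.draw ∧
      c'.samples = c.samples + 1 ∧ boxKnowledge c' =
        boxStep Q signedCoord adv.direction (boxKnowledge c) (ω c.samples) := by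
  -- The `8d + 5` steps are one draw, two scans of `2d + 1`, one query, and at most `4d + 1` steps
  -- to raise the positive bounds.
  classical
  set x := ω c.samples
  have hp : boxProgram d N Q c.control c.samples c.queries =
      .sample (cellIdx d none) (.checkNeg 0) := by rw [hc]; exact boxProgram_sample hN hQ
  have h1 := Learner.reachesIn_one
    (Learner.step_sample (L := boxLearner d N Q) (c := c) (adv := adv) (ω := ω) hp)
  set T := Function.update c.queryTape (cellIdx d none) (some (ω c.samples)) with hT
  have hTpos : posBound T = posBound c.queryTape := posBound_update_none _ _
  have hTneg : negBound T = negBound c.queryTape := negBound_update_none _ _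
  have hTx : T (cellIdx d none) = some x := by rw [hT, Function.update_self]
  have h2 := h1.trans (reachesIn_checkNeg (d * 2) { c with
    control := BoxControl.checkNeg 0, queryTape := T, samples := c.samples + 1 } 0
    (by simp) rfl hTx)
  simp only [Fin.val_zero, Nat.zero_le, true_and, hTneg] at h2
  by_cases hneg : ∃ k, negBound c.queryTape k ≤ signedCoord k x
  · rw [if_pos hneg] at h2
    refine ⟨_, h2.mono (by omega), rfl, rfl, ?_⟩
    rw [boxStep_of_not]
    · simp only [boxKnowledge, hTpos, hTneg]
    · rintro ⟨-, h, -⟩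
      obtain ⟨k, hk⟩ := hneg
      exact absurd (h k) (not_lt.2 hk)
  rw [if_neg hneg] at h2
  have h3 := h2.trans (reachesIn_checkPos (d * 2) { c with
    control := BoxControl.checkPos 0, queryTape := T, samples := c.samples + 1 } 0
    (by simp) rfl hTx)
  simp only [Fin.val_zero, Nat.zero_le, true_and, hTpos] at h3
  by_cases hpos : ∃ k, posBound c.queryTape k < signedCoord k x
  swap
  · rw [if_neg hpos] at h3
    refine ⟨_, h3.mono (by omega), rfl, rfl, ?_⟩
    rw [boxStep_of_not fun h => hpos h.2.2]
    simp only [boxKnowledge, hTpos, hTneg]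
  rw [if_pos hpos] at h3
  have hU : (boxKnowledge c).2.2.1 < Q ∧ x ∈ unsureSet signedCoord (boxKnowledge c) := by
    refine ⟨hQ, fun k => ?_, hpos⟩
    push Not at hneg
    exact hneg k
  have h4 := h3.trans (Learner.reachesIn_one (Learner.step_query (L := boxLearner d N Q)
    (c := { c with control := BoxControl.ask, queryTape := T, samples := c.samples + 1 })
    (j := cellIdx d none)
    (next := fun r => r.elim (.raise 0) fun a => .storeNeg (dirEquiv d a)) rfl hTx))
  rcases hr : adv c.queries c.asked x with _ | a
  · simp only [hr, Option.elim_none] at h4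
    obtain ⟨tape, h5, h6, h7⟩ := reachesIn_raise (adv := adv) (ω := ω) (d * 2) { c with
      control := BoxControl.raise 0, queryTape := T, samples := c.samples + 1,
      queries := c.queries + 1, asked := Function.update c.asked c.queries x } 0 (by simp) rfl hTx
    refine ⟨_, (h4.trans h5).mono (by omega), rfl, rfl, ?_⟩
    have hd : adv.direction (boxKnowledge c).2.2.1 (boxKnowledge c).2.2.2 x = none := by
      simp [Adversary.direction, boxKnowledge, hr]
    rw [boxStep_of_none hU hd]
    simp only [boxKnowledge, Prod.mk.injEq, and_true]
    refine ⟨funext fun k => ?_, funext fun k => ?_⟩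
    · rw [h7 k]
      simp [hTpos]
    · rw [h6 k]
      simp [hTneg]
  · simp only [hr, Option.elim_some] at h4
    have h5 := h4.trans (Learner.reachesIn_one (Learner.step_copy (L := boxLearner d N Q)
      (c := { c with
        control := BoxControl.storeNeg (dirEquiv d a), queryTape := T,
        samples := c.samples + 1, queries := c.queries + 1,
        asked := Function.update c.asked c.queries x })
      (j := cellIdx d none) (k := cellIdx d (some (false, dirEquiv d a)))
      (next := BoxControl.draw) rfl))
    refine ⟨_, h5.mono (by omega), rfl, rfl, ?_⟩
    have hd : adv.direction (boxKnowledge c).2.2.1 (boxKnowledge c).2.2.2 x =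
        some (dirEquiv d a) := by
      simp [Adversary.direction, boxKnowledge, hr]
    rw [boxStep_of_some hU hd]
    simp only [boxKnowledge, hTx, posBound_update_neg, negBound_update_neg, hTpos, hTneg]
    congr!

/-- The knowledge of the learner before the first sample. -/
noncomputable def emptyKnowledge (d : ℕ) : BoxState (Fin (d * 2)) (Fin d → ℝ) :=
  (fun _ => ⊥, fun _ => ⊤, 0, fun _ => 0)

theorem isConsistent_emptyKnowledge (h : Rectangle d) :
    IsConsistent signedCoord h.side (emptyKnowledge d) :=
  ⟨fun _ => bot_le, fun k x _ => signedCoord_lt_top k x⟩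

/-- The knowledge of the learner after `t` samples. -/
noncomputable def knowledgeAfter (adv : Adversary d) (Q : ℕ) (ω : ℕ → Fin d → ℝ) (t : ℕ) :
    BoxState (Fin (d * 2)) (Fin d → ℝ) :=
  drivenChain (boxStep Q signedCoord adv.direction) (emptyKnowledge d) ω t

/-- The machine may stop drawing before `t` samples once the budget is spent; the abstract process
ignores all later points, so the knowledge still agrees. -/
theorem exists_run_eq_knowledgeAfter (t : ℕ) (ht : t ≤ N) :
    ∃ c, (boxLearner d N Q).ReachesIn adv ω (t * (8 * d + 5)) (boxLearner d N Q).init c ∧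
      c.control = BoxControl.draw ∧ boxKnowledge c = knowledgeAfter adv Q ω t ∧
      (c.samples = t ∨ Q ≤ c.queries) := by
  induction t with
  | zero => exact ⟨_, .refl _ _, rfl, rfl, .inl rfl⟩
  | succ t ih =>
    obtain ⟨c, h1, h2, h3, h4⟩ := ih (by omega)
    have hsucc : knowledgeAfter adv Q ω (t + 1) =
        boxStep Q signedCoord adv.direction (boxKnowledge c) (ω t) := by rw [h3]; rfl
    by_cases hQ : Q ≤ c.queries
    · refine ⟨c, h1.mono (Nat.mul_le_mul_right _ t.le_succ), h2, ?_, .inr hQ⟩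
      rw [hsucc, boxStep_of_not fun h => absurd h.1 (not_lt.2 hQ)]
    · have hs := h4.resolve_right hQ
      obtain ⟨c', h5, h6, h7, h8⟩ :=
        exists_reachesIn_draw (adv := adv) (ω := ω) c h2 (by omega) (not_le.1 hQ)
      refine ⟨c', (h1.trans h5).mono (Nat.succ_mul _ _).ge, h6, ?_, .inl (by rw [h7, hs])⟩
      rw [h8, hsucc, hs]

theorem knowledgeAfter_queries_le (t : ℕ) : (knowledgeAfter adv Q ω t).2.2.1 ≤ Q :=
  drivenChain_induction (I := fun s : BoxState (Fin (d * 2)) (Fin d → ℝ) => s.2.2.1 ≤ Q)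
    (Nat.zero_le _) (fun _ x hs => boxStep_queries_le x hs) ω t

theorem isConsistent_knowledgeAfter {h : Rectangle d} (hadv : adv.IsValid h) (t : ℕ) :
    IsConsistent signedCoord h.side (knowledgeAfter adv Q ω t) :=
  drivenChain_induction (isConsistent_emptyKnowledge h)
    (fun _ x hs => hs.boxStep hadv.isCorrectResp x) ω t

/-- The learner halts in time, with the knowledge obtained from `N` samples. -/
theorem exists_haltedAt (adv : Adversary d) (ω : ℕ → Fin d → ℝ) :
    ∃ t ≤ N * (8 * d + 5), (boxLearner d N Q).HaltedAt adv ω t ∧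
      boxKnowledge ((boxLearner d N Q).run adv ω t) = knowledgeAfter adv Q ω N := by
  obtain ⟨c, ⟨t, ht, h1⟩, h2, h3, h4⟩ := exists_run_eq_knowledgeAfter (N := N) (Q := Q)
    (adv := adv) (ω := ω) N le_rfl
  have hrun : (boxLearner d N Q).run adv ω t = c := h1
  refine ⟨t, ht, ?_, by rw [hrun, h3]⟩
  rw [Learner.HaltedAt, hrun]
  refine Learner.step_halt (L := boxLearner d N Q) ?_
  change boxProgram d N Q c.control c.samples c.queries = _
  rw [h2]
  exact if_pos (h4.imp (fun h => h.ge) id)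

open Classical in
theorem result_boxLearner (adv : Adversary d) (ω : ℕ → Fin d → ℝ) (x : Fin d → ℝ) :
    (boxLearner d N Q).result adv ω x =
      if ∃ j, (knowledgeAfter adv Q ω N).2.1 j ≤ signedCoord j x then some false
      else if ∀ j, signedCoord j x ≤ (knowledgeAfter adv Q ω N).1 j then some true
      else none := by
  obtain ⟨t, -, h1, h2⟩ := exists_haltedAt (N := N) (Q := Q) adv ω
  rw [Learner.result_eq_of_haltedAt h1, ← h2]
  rfl

theorem result_boxLearner_eq_none_iff (adv : Adversary d) (ω : ℕ → Fin d → ℝ) (x : Fin d → ℝ) :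
    (boxLearner d N Q).result adv ω x = none ↔
      x ∈ unsureSet signedCoord (knowledgeAfter adv Q ω N) := by
  rw [result_boxLearner]
  split_ifs with h1 h2
  · simp only [false_iff]
    rintro ⟨h, -⟩
    obtain ⟨j, hj⟩ := h1
    exact absurd (h j) (not_lt.2 hj)
  · simp only [false_iff]
    rintro ⟨-, k, hk⟩
    exact absurd (h2 k) (not_le.2 hk)
  · push Not at h1 h2
    exact iff_of_true rfl ⟨h1, h2⟩

theorem isReliable_boxLearner (d N Q : ℕ) : (boxLearner d N Q).IsReliable := by
  intro h adv hadv ω x hx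
  have hcons := isConsistent_knowledgeAfter (Q := Q) (ω := ω) hadv N
  rw [result_boxLearner] at hx ⊢
  split_ifs at hx ⊢ with h1 h2
  · obtain ⟨j, hj⟩ := h1
    have : x ∉ h.carrier := fun hm =>
      absurd (hcons.2 j x ((h.mem_carrier_iff x).1 hm j)) (not_lt.2 hj)
    simp [Rectangle.label, this]
  · have : x ∈ h.carrier := (h.mem_carrier_iff x).2 fun j => (h2 j).trans (hcons.1 j)
    simp [Rectangle.label, this]
  · exact absurd rfl hx

theorem runsWithin_boxLearner {q T : ℝ} (hq : (Q : ℝ) ≤ q)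
    (hT : (N * (8 * d + 5) : ℝ) ≤ T) : (boxLearner d N Q).RunsWithin q T := by
  intro h adv _ ω
  obtain ⟨t, ht, h1, h2⟩ := exists_haltedAt (N := N) (Q := Q) adv ω
  refine ⟨t, le_trans (by exact_mod_cast ht) hT, h1, le_trans ?_ hq⟩
  have : ((boxLearner d N Q).run adv ω t).queries = (knowledgeAfter adv Q ω N).2.2.1 := by
    rw [← h2]; rfl
  rw [this]
  exact_mod_cast knowledgeAfter_queries_le N

theorem isProbablyUseful_boxLearner (hd : 1 ≤ d) {ε δ : ℝ} (hε0 : 0 < ε) (hε1 : ε < 1)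
    (hδ : (1 - 1 / (32 * d)) ^ Q / (ε / 2) + (1 - ε / (32 * d)) ^ N / (ε / 2) < δ) (hδ0 : 0 < δ) :
    (boxLearner d N Q).IsProbablyUseful ε δ := by
  intro D _ h adv hadv hmeas
  have key := measure_unsure_le (Q := Q) D measurable_signedCoord hmeas.direction
    (by rw [Fintype.card_fin]; omega) hadv.isCorrectResp (isConsistent_emptyKnowledge h) rfl
    hε0 hε1 N
  have hcard : (16 * (Fintype.card (Fin (d * 2)) : ℝ)) = 32 * d := by
    rw [Fintype.card_fin]; push_cast; ring
  rw [hcard] at key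
  have hset : {ω | ENNReal.ofReal ε < D {x | (boxLearner d N Q).result adv ω x = none}} =
      {ω | ε < D.real (unsureSet signedCoord (knowledgeAfter adv Q ω N))} := by
    ext ω
    have : {x | (boxLearner d N Q).result adv ω x = none} =
        unsureSet signedCoord (knowledgeAfter adv Q ω N) := by
      ext x; exact result_boxLearner_eq_none_iff adv ω x
    simp only [mem_ofPred_eq, this]
    rw [ENNReal.ofReal_lt_iff_lt_toReal hε0.le (measure_ne_top _ _)]
    rfl
  rw [hset]
  exact key.trans_lt ((ENNReal.ofReal_lt_ofReal_iff hδ0).2 hδ)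

end Run

/-! ### Choice of the budgets and constants -/

theorem one_sub_pow_ceil_le {σ y : ℝ} (hσ0 : 0 < σ) (hσ1 : σ ≤ 1) (hy : 0 < y) {n : ℕ}
    (hn : Real.log (1 / y) / σ ≤ n) : (1 - σ) ^ n ≤ y := by
  have h1 : Real.log (1 / y) ≤ σ * n := by
    rw [div_le_iff₀ hσ0] at hn; linarith
  calc (1 - σ) ^ n ≤ Real.exp (-σ) ^ n := by
        exact pow_le_pow_left₀ (by linarith) (by linarith [Real.add_one_le_exp (-σ)]) n
    _ = Real.exp (-(σ * n)) := by rw [← Real.exp_nat_mul]; ring_nf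
    _ ≤ Real.exp (-Real.log (1 / y)) := Real.exp_le_exp.2 (by linarith)
    _ = y := by rw [one_div, Real.log_inv, neg_neg, Real.exp_log hy]

theorem mainTheorem7 :
    ∃ C : ℝ, 0 < C ∧ ∀ d : ℕ, 1 ≤ d → ∃ M : ℕ, (M : ℝ) ≤ C * d ∧
      ∀ ε δ : ℝ, 0 < ε → ε < 1 → 0 < δ → δ < 1 →
        ∃ L : Learner d, L.IsRPULearner ε δ ∧ L.memory ≤ M ∧
          L.RunsWithin (C * (d * Real.log (2 / (ε * δ))))
            (C * (d ^ 2 * Real.log (2 * d / (ε * δ)) * Real.log (2 / (ε * δ)) / ε)) := by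
  refine ⟨3000, by norm_num, fun d hd => ⟨14 * d + 6, ?_, fun ε δ hε0 hε1 hδ0 hδ1 => ?_⟩⟩
  · have : (1 : ℝ) ≤ d := by exact_mod_cast hd
    push_cast; linarith
  have hd' : (1 : ℝ) ≤ d := by exact_mod_cast hd
  have hεδ : 0 < ε * δ := mul_pos hε0 hδ0
  have hεδ1 : ε * δ ≤ 1 := by nlinarith
  set l := Real.log (2 / (ε * δ)) with hl
  have hlog2 : 1 / 2 ≤ Real.log 2 := by linarith [Real.log_two_gt_d9]
  have hl2 : 1 / 2 ≤ l := hlog2.trans <| Real.log_le_log (by norm_num) <| by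
    rw [le_div_iff₀ hεδ]; linarith
  have hl' : 1 / 2 ≤ Real.log (2 * d / (ε * δ)) := hlog2.trans <|
    Real.log_le_log (by norm_num) <| by rw [le_div_iff₀ hεδ]; nlinarith
  -- Since `ε * δ ≤ 1`, `8 / (ε * δ)` is at most the cube of `2 / (ε * δ)`.
  have hl8 : Real.log (1 / (ε * δ / 8)) ≤ 3 * l := by
    have h1 : (3 : ℝ) * l = Real.log ((2 / (ε * δ)) ^ 3) := by
      rw [Real.log_pow]; norm_num [hl]
    rw [h1]
    apply Real.log_le_log (by positivity)
    rw [div_pow, one_div_div, div_le_div_iff₀ hεδ (by positivity)]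
    have : (ε * δ) ^ 3 ≤ ε * δ := pow_le_of_le_one hεδ.le hεδ1 (by norm_num)
    linarith
  have hl80 : 0 ≤ Real.log (1 / (ε * δ / 8)) := Real.log_nonneg (by
    rw [le_div_iff₀ (by positivity)]; linarith)
  -- Both budgets bring their power down to `ε * δ / 8`; division by `ε / 2` makes each error term
  -- at most `δ / 4`.
  set Q := ⌈Real.log (1 / (ε * δ / 8)) / (1 / (32 * d : ℝ))⌉₊ with hQ
  set N := ⌈Real.log (1 / (ε * δ / 8)) / (ε / (32 * d : ℝ))⌉₊ with hN
  -- Here `98 = 32 * 3 + 2`: rounding up costs `1 ≤ 2 * (d * l)`.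
  have hQle : (Q : ℝ) ≤ 98 * (d * l) := by
    have h1 := (Nat.ceil_lt_add_one (a := Real.log (1 / (ε * δ / 8)) / (1 / (32 * d : ℝ)))
      (by positivity)).le
    rw [← hQ, div_div_eq_mul_div, div_one] at h1
    nlinarith
  have hNle : (N : ℝ) ≤ 98 * (d * l) / ε := by
    have h1 := (Nat.ceil_lt_add_one (a := Real.log (1 / (ε * δ / 8)) / (ε / (32 * d : ℝ)))
      (by positivity)).le
    rw [← hN, div_div_eq_mul_div] at h1
    have h2 : Real.log (1 / (ε * δ / 8)) * (32 * d) / ε + 1 ≤ 98 * (d * l) / ε := by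
      rw [div_add_one hε0.ne']
      gcongr
      nlinarith
    linarith
  refine ⟨boxLearner d N Q, ⟨isProbablyUseful_boxLearner hd hε0 hε1 ?_ hδ0,
    isReliable_boxLearner d N Q⟩, boxLearner_memory_le d N Q, runsWithin_boxLearner ?_ ?_⟩
  · have h1 : (1 - 1 / (32 * d : ℝ)) ^ Q ≤ ε * δ / 8 :=
      one_sub_pow_ceil_le (by positivity) (by rw [div_le_one (by positivity)]; linarith)
        (by positivity) (Nat.le_ceil _)
    have h2 : (1 - ε / (32 * d : ℝ)) ^ N ≤ ε * δ / 8 :=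
      one_sub_pow_ceil_le (by positivity) (by rw [div_le_one (by positivity)]; linarith)
        (by positivity) (Nat.le_ceil _)
    calc _ ≤ ε * δ / 8 / (ε / 2) + ε * δ / 8 / (ε / 2) := by gcongr
      _ = δ / 2 := by field_simp; norm_num
      _ < δ := by linarith
  · refine hQle.trans ?_
    have : 0 ≤ d * l := by positivity
    linarith
  · have h1 : (8 * d + 5 : ℝ) ≤ 13 * d := by linarith
    calc (N * (8 * d + 5) : ℝ) ≤ 98 * (d * l) / ε * (13 * d) := by gcongr
      _ = 2548 * (d ^ 2 * (1 / 2) * l / ε) := by ring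
      -- The construction does not need the logarithm containing `d`; only its lower bound `1 / 2`
      -- enters.
      _ ≤ 3000 * (d ^ 2 * Real.log (2 * d / (ε * δ)) * l / ε) := by gcongr; norm_num
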